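/- There is an absolute constant $C\ge 0$ such that the following holds. Setting. Let $d,n\ge 1$, $L>0$, and let $f_1,\dots,f_n:\mathbb R^d\to\mathbb R$ be convex and differentiable with $\|\nabla f_i(x)-\nabla f_i(y)\|\le L\|x-y\|$ for all $x,y$ (Euclidean norm). Put $f=\frac1n\sum_{i=1}^n f_i$. For smoothing parameters $\mu,\nu>0$ put $$f_\mu(x)=\mathbb E_{u\sim\mathcal N(0,I_d)}[f(x+\mu u)],\qquad g_\mu(x,u,i)=\frac{f_i(x+\mu u)-f_i(x)}{\mu}\,u,\qquad g_\nu(x)=\sum_{j=1}^d\frac{f(x+\nu e_j)-f(x-\nu e_j)}{2\nu}\,e_j .$$ Parameters. Let $s_0=\lfloor\log_2((d+4)n)\rfloor+1$ and, for $s\ge 1$, $$T_s=\begin{cases}2^{s-1},&s\le s_0\\ 2^{s_0-1},&s>s_0\end{cases},\quad \alpha_s=\begin{cases}\frac12,&s\le s_0\\ \frac{2}{s-s_0+4},&s>s_0\end{cases},\quad \gamma_s=\frac{1}{12(d+4)L\alpha_s},\quad p_s=\frac12,$$ and, in epoch $s$, $\theta_t=\frac{\gamma_s}{\alpha_s}(\alpha_s+p_s)$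 for $1\le t\le T_s-1$ and $\theta_{T_s}=\frac{\gamma_s}{\alpha_s}$. Algorithm (ZO-Varag). Let $x^0\in\mathbb R^d$ and $\tilde x^0=x^0$. In epoch $s=1,2,\dots$ set $\tilde x=\tilde x^{s-1}$, $x_0=x^{s-1}$, $\bar x_0=\tilde x$, $\tilde g=g_\nu(\tilde x)$, and for $t=1,\dots,T_s$, with fresh independent $u_t\sim\mathcal N(0,I_d)$ and $i_t$ uniform on $\{1,\dots,n\}$ (all draws independent), set $$\underline x_t=(1-\alpha_s-p_s)\bar x_{t-1}+\alpha_s x_{t-1}+p_s\tilde x,\qquad G_t=g_\mu(\underline x_t,u_t,i_t)-g_\mu(\tilde x,u_t,i_t)+\tilde g,$$ $$x_t=\operatorname*{arg\,min}_{x\in\mathbb R^d}\Big\{\gamma_s\langle G_t,x\rangle+\tfrac12\|x_{t-1}-x\|^2\Big\}=x_{t-1}-\gamma_sG_t,\qquad \bar x_t=(1-\alpha_s-p_s)\bar x_{t-1}+\alpha_s x_t+p_s\tilde x .$$ At the end of the epoch set $x^s=x_{T_s}$ and $\tilde x^s=\sum_{t=1}^{T_s}\theta_t\bar x_t\big/\sum_{t=1}^{T_s}\theta_t$.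 Assumption. Let $x_\mu^*$ be a minimizer of $f_\mu$, $f_\mu^*=f_\mu(x_\mu^*)$, and suppose that, for the given $\mu$ and $\nu$, the number $Z<\infty$ satisfies $\sup_{s\ge 0}\mathbb E\|\tilde x^s-x_\mu^*\|\le Z$. Conclusion. Put $E=2L^2d\nu^2+\frac12\mu^2L^2(d+3)^3$, $\varsigma_1=\mu^2L(d+4)^2$, $\varsigma_2=Z\sqrt E$ and $$D_0=\frac{2}{d+4}\big[f_\mu(x^0)-f_\mu(x_\mu^*)\big]+6L\|x^0-x_\mu^*\|^2 .$$ Then for every $s\ge 1$ the random variable $f_\mu(\tilde x^s)-f_\mu^*$ is integrable and $$\mathbb E\big[f_\mu(\tilde x^s)-f_\mu^*\big]\le\begin{cases}\dfrac{(d+4)D_0}{2^{s+1}}+2\varsigma_1+3\varsigma_2,&1\le s\le s_0,\\[2ex]\dfrac{16D_0}{n(s-s_0+4)^2}+\delta_s(\varsigma_1+\varsigma_2),&s>s_0,\end{cases}\qquad\text{where }\delta_s=C\,(s-s_0).$$ -/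

import Mathlib

open MeasureTheory ProbabilityTheory

noncomputable section

namespace ZOVarag

/-- The ambient space `ℝ^d` with its Euclidean norm. -/
abbrev Vec (d : ℕ) := EuclideanSpace ℝ (Fin d)

variable {d n : ℕ}

/-! ### Objective, smoothing and gradient estimators -/

/-- The finite-sum objective `f = (1/n) ∑ f_i`. -/
def average (f : Fin n → Vec d → ℝ) (x : Vec d) : ℝ :=
  (1 / (n : ℝ)) * ∑ i, f i x

/-- Gaussian smoothing `h_μ(x) = E_u[h(x + μ u)]`, `u ∼ N(0, I_d)`. -/
def smoothed (h : Vec d → ℝ) (μ : ℝ) (x : Vec d) : ℝ :=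
  ∫ u, h (x + μ • u) ∂(stdGaussian (Vec d))

/-- Two-point estimator `((h(x + μ u) - h(x)) / μ) u`. -/
def gaussEst (h : Vec d → ℝ) (μ : ℝ) (x u : Vec d) : Vec d :=
  ((h (x + μ • u) - h x) / μ) • u

/-- Coordinate-wise estimator `∑_j ((h(x + ν e_j) - h(x - ν e_j)) / (2ν)) e_j`. -/
def coordEst (h : Vec d → ℝ) (ν : ℝ) (x : Vec d) : Vec d :=
  ∑ j : Fin d,
    ((h (x + ν • EuclideanSpace.single j (1 : ℝ)) - h (x - ν • EuclideanSpace.single j (1 : ℝ)))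
      / (2 * ν)) • EuclideanSpace.single j (1 : ℝ)

/-- Each `f_i` is convex, differentiable and has an `L`-Lipschitz gradient. -/
structure ConvexSmooth (f : Fin n → Vec d → ℝ) (L : ℝ) : Prop where
  convex : ∀ i, ConvexOn ℝ Set.univ (f i)
  differentiable : ∀ i, Differentiable ℝ (f i)
  smooth : ∀ i x y, ‖gradient (f i) x - gradient (f i) y‖ ≤ L * ‖x - y‖

/-! ### The algorithm -/

/-- Parameters of the algorithm; epochs `s` are numbered from `1`, and the weight `θ s t` is the
weight of inner iteration `t` in epoch `s`. -/
structure Params where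
  T : ℕ → ℕ
  γ : ℕ → ℝ
  α : ℕ → ℝ
  p : ℕ → ℝ
  θ : ℕ → ℕ → ℝ
  τ : ℝ

/-- The point `x̲_t`, from `x_{t-1}`, `x̄_{t-1}` and the pivot `x̃`. -/
def queryPoint (γ α p τ : ℝ) (x xbar pivot : Vec d) : Vec d :=
  (1 + τ * γ * (1 - α))⁻¹ •
    (((1 + τ * γ) * (1 - α - p)) • xbar + α • x + ((1 + τ * γ) * p) • pivot)

/-- The point `x_t`: the minimizer of
`y ↦ γ (⟪G, y⟫ + (τ/2) ‖x̲_t - y‖²) + (1/2) ‖x_{t-1} - y‖²` (see `proxStep_isMinOn`). -/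
def proxStep (γ τ : ℝ) (G xunder x : Vec d) : Vec d :=
  (1 + γ * τ)⁻¹ • (x + (γ * τ) • xunder - γ • G)

theorem proxStep_isMinOn (γ τ : ℝ) (hγ : 0 ≤ γ) (hτ : 0 ≤ τ) (G xunder x : Vec d) :
    IsMinOn (fun y : Vec d =>
      γ * (inner ℝ G y + τ / 2 * ‖xunder - y‖ ^ 2) + 1 / 2 * ‖x - y‖ ^ 2)
      Set.univ (proxStep γ τ G xunder x) := by
  intro y _
  set z := proxStep γ τ G xunder x with hz
  have hpos : 0 < 1 + γ * τ := by positivity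
  have hG : γ • G = x + (γ * τ) • xunder - (1 + γ * τ) • z := by
    rw [hz, proxStep, smul_inv_smul₀ hpos.ne']
    abel
  have h1 : ∀ w : Vec d, γ * inner ℝ G w =
      inner ℝ x w + (γ * τ) * inner ℝ xunder w - (1 + γ * τ) * inner ℝ z w := by
    intro w
    have := congrArg (fun v => inner ℝ v w) hG
    simpa [inner_sub_left, inner_add_left, real_inner_smul_left] using this
  have hsq : 0 ≤ (1 + γ * τ) * ‖y - z‖ ^ 2 := by positivity
  have e1 := norm_sub_sq_real xunder y
  have e2 := norm_sub_sq_real xunder z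
  have e3 := norm_sub_sq_real x y
  have e4 := norm_sub_sq_real x z
  have e5 := norm_sub_sq_real y z
  have e6 : inner ℝ y z = inner ℝ z y := real_inner_comm _ _
  have e7 : inner ℝ z z = ‖z‖ ^ 2 := real_inner_self_eq_norm_sq z
  have hy := h1 y
  have hzz := h1 z
  simp only [Set.mem_ofPred_eq]
  rw [e1, e2, e3, e4]
  rw [e5, e6] at hsq
  rw [e7] at hzz
  nlinarith [hy, hzz, hsq]

/-- The pair `(x_t, x̄_t)` after `t` inner iterations of an epoch with pivot `pivot`, started from
`x_0 = x0`, `x̄_0 = pivot`; the pair `ξ t = (u_t, i_t)` is the sample drawn at iteration `t ≥ 1`. -/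
def innerIter (f : Fin n → Vec d → ℝ) (μ ν γ α p τ : ℝ) (x0 pivot : Vec d)
    (ξ : ℕ → Vec d × Fin n) : ℕ → Vec d × Vec d
  | 0 => (x0, pivot)
  | t + 1 =>
    let prev := innerIter f μ ν γ α p τ x0 pivot ξ t
    let u := (ξ (t + 1)).1
    let i := (ξ (t + 1)).2
    let xunder := queryPoint γ α p τ prev.1 prev.2 pivot
    let G := gaussEst (f i) μ xunder u - gaussEst (f i) μ pivot u + coordEst (average f) ν pivot
    let x := proxStep γ τ G xunder prev.1
    (x, (1 - α - p) • prev.2 + α • x + p • pivot)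

/-- The pair `(x^s, x̃^s)` after `s` epochs, with pivot `x̃ = x̃^{s-1}` in epoch `s`; the pair
`ξ s t = (u_t, i_t)` is the sample drawn at inner iteration `t ≥ 1` of epoch `s ≥ 1`. -/
def epoch (P : Params) (f : Fin n → Vec d → ℝ) (μ ν : ℝ) (x0 : Vec d)
    (ξ : ℕ → ℕ → Vec d × Fin n) : ℕ → Vec d × Vec d
  | 0 => (x0, x0)
  | s + 1 =>
    let prev := epoch P f μ ν x0 ξ s
    let it := innerIter f μ ν (P.γ (s + 1)) (P.α (s + 1)) (P.p (s + 1)) P.τ prev.1 prev.2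
      (ξ (s + 1))
    ((it (P.T (s + 1))).1,
      (∑ t ∈ Finset.Icc 1 (P.T (s + 1)), P.θ (s + 1) t)⁻¹ •
        ∑ t ∈ Finset.Icc 1 (P.T (s + 1)), P.θ (s + 1) t • (it t).2)

/-- The samples: all pairs `(u_{s,t}, i_{s,t})` are independent, `u_{s,t} ∼ N(0, I_d)`, and
`i_{s,t}` is uniform on the `n` indices and independent of `u_{s,t}`. -/
structure IsSampling {Ω : Type*} [MeasurableSpace Ω] (P : Measure Ω)
    (u : ℕ → ℕ → Ω → Vec d) (i : ℕ → ℕ → Ω → Fin n) : Prop where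
  measurable_u : ∀ s t, Measurable (u s t)
  measurable_i : ∀ s t, Measurable (i s t)
  law_u : ∀ s t, P.map (u s t) = stdGaussian (Vec d)
  law_i : ∀ s t, P.map (i s t) = uniformOn Set.univ
  indep_pair : ∀ s t, IndepFun (u s t) (i s t) P
  iIndep : iIndepFun (fun (k : ℕ × ℕ) (ω : Ω) => (u k.1 k.2 ω, i k.1 k.2 ω)) P

/-- The random pivot `x̃^s` produced by the algorithm. -/
def pivot {Ω : Type*} (P : Params) (f : Fin n → Vec d → ℝ) (μ ν : ℝ) (x0 : Vec d)
    (u : ℕ → ℕ → Ω → Vec d) (i : ℕ → ℕ → Ω → Fin n) (s : ℕ) (ω : Ω) : Vec d :=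
  (epoch P f μ ν x0 (fun s t => (u s t ω, i s t ω)) s).2

/-! ### The schedule for smooth convex objectives, and the constants of the bound -/

/-- `s₀ = ⌊log₂((d+4) n)⌋ + 1`. -/
def s0 (d n : ℕ) : ℕ := Nat.log 2 ((d + 4) * n) + 1

def schedT (d n s : ℕ) : ℕ := if s ≤ s0 d n then 2 ^ (s - 1) else 2 ^ (s0 d n - 1)

def schedα (d n s : ℕ) : ℝ := if s ≤ s0 d n then 1 / 2 else 2 / ((s : ℝ) - (s0 d n : ℝ) + 4)

def schedγ (d n : ℕ) (L : ℝ) (s : ℕ) : ℝ := 1 / (12 * ((d : ℝ) + 4) * L * schedα d n s)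

def schedθ (d n : ℕ) (L : ℝ) (s t : ℕ) : ℝ :=
  if t < schedT d n s then schedγ d n L s / schedα d n s * (schedα d n s + 1 / 2)
  else schedγ d n L s / schedα d n s

/-- The parameters for merely convex objectives (no strong convexity: `τ = 0`). -/
def convexParams (d n : ℕ) (L : ℝ) : Params where
  T := schedT d n
  γ := schedγ d n L
  α := schedα d n
  p := fun _ => 1 / 2
  θ := schedθ d n L
  τ := 0

/-- `E = 2 L² d ν² + μ² L² (d+3)³ / 2`. -/
def errE (d : ℕ) (L μ ν : ℝ) : ℝ :=
  2 * L ^ 2 * d * ν ^ 2 + μ ^ 2 * L ^ 2 * ((d : ℝ) + 3) ^ 3 / 2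

/-- `ς₁ = μ² L (d+4)²`. -/
def err1 (d : ℕ) (L μ : ℝ) : ℝ := μ ^ 2 * L * ((d : ℝ) + 4) ^ 2

/-- `ς₂ = Z √E`. -/
def err2 (d : ℕ) (L μ ν Z : ℝ) : ℝ := Z * Real.sqrt (errE d L μ ν)

/-- `D₀ = (2/(d+4)) (f_μ(x⁰) - f_μ(x_μ^*)) + 6 L ‖x⁰ - x_μ^*‖²`. -/
def D0 (f : Fin n → Vec d → ℝ) (L μ : ℝ) (x0 xstar : Vec d) : ℝ :=
  2 / ((d : ℝ) + 4) * (smoothed (average f) μ x0 - smoothed (average f) μ xstar)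
    + 6 * L * ‖x0 - xstar‖ ^ 2

end ZOVarag

end

/-! Within an epoch with pivot p the gradient estimate is G_t = ∇f_μ(x̲_t) + b + δ_t. Here b =
g_ν(p) − ∇f_μ(p) is the bias of the coordinate estimator, constant during the epoch, and δ_t has
mean zero given the past. The bias is not paid at every step but moved into the objective:
`potential`, the gap of f_μ plus ⟨b, y − x*⟩, is still convex and L-smooth in y, and for it G_t is
unbiased. The tilt is removed only at the two ends of the epoch, by Cauchy–Schwarz
(`integral_potential_sub_abs_le`). Those ends are pivots, where Z bounds the expected distance to
x*, so the price is ς₂ per unit of weight.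

One step (`potential_step_le`) is the usual accelerated estimate: smoothness from x̲_t to x̄_t,
convexity from x̲_t to x̄_{t-1} and to x*. At the pivot the Bregman gap D of f_μ is retained with
coefficient −p_s = −1/2. The second moment of the noise is at most 12dL·D plus terms of order
μ²L²(d² + d³), by Gaussian moments and cocoercivity. Since γα = 1/(12(d+4)L), it contributes at most
D/2 + ς₁, and D cancels.

The weights θ_t are those produced by summing the steps, and Jensen passes to the averaged point
(`epoch_recursion`). The schedule makes the weight on the incoming pivot at most the weight the
preceding epoch left on it, so epochs chain. The weight doubles up to s₀ and then grows like T(s −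
s₀ + 4)²/((d+4)L), with 2T = 2^{s₀} ≥ (d+4)n. Errors sum geometrically in the early epochs, and each
late epoch adds at most 2(ς₁ + ς₂) relative to the current weight.

The gradient of f_μ enters only as `smoothGrad`, through tangent and quadratic inequalities averaged
over the Gaussian; f_μ is never differentiated. -/

noncomputable section

namespace ZOVarag

/-! ### Convex functions with Lipschitz gradient. -/

section SmoothConvex

variable {E : Type*} [NormedAddCommGroup E] [InnerProductSpace ℝ E] [CompleteSpace E]
  {h : E → ℝ} {L : ℝ}

theorem hasDerivAt_lineMap (hd : Differentiable ℝ h) (x v : E) (t : ℝ) :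
    HasDerivAt (fun t : ℝ => h (x + t • v)) (inner ℝ (gradient h (x + t • v)) v) t := by
  have h1 : HasDerivAt (fun t : ℝ => x + t • v) v t := by
    simpa using ((hasDerivAt_id t).smul_const v).const_add x
  have h2 := (hd (x + t • v)).hasFDerivAt.comp_hasDerivAt t h1
  rw [inner_gradient_left]
  exact h2

theorem add_inner_gradient_le (hc : ConvexOn ℝ Set.univ h) (hd : Differentiable ℝ h) (x y : E) :
    h x + inner ℝ (gradient h x) (y - x) ≤ h y := by
  have hconv : ConvexOn ℝ Set.univ (fun t : ℝ => h (x + t • (y - x))) := by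
    have := hc.comp_affineMap (AffineMap.lineMap x y : ℝ →ᵃ[ℝ] E)
    simpa [Function.comp_def, AffineMap.lineMap_apply, add_comm] using this
  have h0 := hasDerivAt_lineMap hd x (y - x) 0
  have := hconv.le_slope_of_hasDerivAt (Set.mem_univ _) (Set.mem_univ _) zero_lt_one h0
  simp only [slope_def_field, zero_smul, add_zero, one_smul, sub_zero, div_one,
    add_sub_cancel] at this
  linarith

theorem le_add_inner_gradient (hd : Differentiable ℝ h)
    (hL : ∀ x y, ‖gradient h x - gradient h y‖ ≤ L * ‖x - y‖) (x y : E) :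
    h y ≤ h x + inner ℝ (gradient h x) (y - x) + L / 2 * ‖y - x‖ ^ 2 := by
  set v := y - x with hv
  let ψ : ℝ → ℝ := fun t =>
    h (x + t • v) - (h x + t * inner ℝ (gradient h x) v + L / 2 * t ^ 2 * ‖v‖ ^ 2)
  have hψ : ∀ t, HasDerivAt ψ (inner ℝ (gradient h (x + t • v)) v
      - (inner ℝ (gradient h x) v + L * t * ‖v‖ ^ 2)) t := by
    intro t
    refine (hasDerivAt_lineMap hd x v t).sub ?_
    have h1 := ((hasDerivAt_id t).mul_const (inner ℝ (gradient h x) v)).const_add (h x)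
    have h2 := (((hasDerivAt_id t).pow 2).const_mul (L / 2)).mul_const (‖v‖ ^ 2)
    refine (h1.add h2).congr_deriv ?_
    simp only [id_eq, one_mul, Nat.cast_ofNat, mul_one, Nat.reduceSub, pow_one]
    ring
  have hanti : AntitoneOn ψ (Set.Icc 0 1) := by
    refine antitoneOn_of_deriv_nonpos (convex_Icc 0 1)
      (fun t _ => (hψ t).continuousAt.continuousWithinAt)
      (fun t _ => (hψ t).differentiableAt.differentiableWithinAt) ?_
    intro t ht
    rw [interior_Icc] at ht
    rw [(hψ t).deriv]
    have h1 : inner ℝ (gradient h (x + t • v) - gradient h x) v ≤ L * t * ‖v‖ ^ 2 := by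
      refine (real_inner_le_norm _ _).trans ?_
      have := hL (x + t • v) x
      rw [add_sub_cancel_left, norm_smul, Real.norm_of_nonneg ht.1.le] at this
      nlinarith [norm_nonneg v]
    rw [inner_sub_left] at h1
    linarith
  have := hanti (by simp) (by simp) (zero_le_one' ℝ)
  simp only [ψ, zero_smul, add_zero, one_smul, zero_mul, one_mul, mul_one, one_pow, mul_zero,
    ne_eq, OfNat.ofNat_ne_zero, not_false_eq_true, zero_pow, sub_self] at this
  rw [show x + v = y by simp [hv]] at this
  linarith

/-- Cocoercivity: at the point y + L⁻¹g, with g the gradient difference, the tangent at x lies below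
the function and the quadratic model at y lies above it. -/
theorem norm_sq_gradient_sub_le (hc : ConvexOn ℝ Set.univ h) (hd : Differentiable ℝ h) (hL0 : 0 < L)
    (hL : ∀ x y, ‖gradient h x - gradient h y‖ ≤ L * ‖x - y‖) (x y : E) :
    ‖gradient h x - gradient h y‖ ^ 2 ≤ 2 * L * (h y - h x - inner ℝ (gradient h x) (y - x)) := by
  set g := gradient h x - gradient h y with hg
  have h1 := add_inner_gradient_le hc hd x (y + L⁻¹ • g)
  have h2 := le_add_inner_gradient hd hL y (y + L⁻¹ • g)
  rw [add_sub_cancel_left, norm_smul, mul_pow, inner_smul_right, norm_inv,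
    Real.norm_of_nonneg hL0.le] at h2
  rw [show y + L⁻¹ • g - x = (y - x) + L⁻¹ • g by abel, inner_add_right, inner_smul_right] at h1
  have h3 : inner ℝ (gradient h x) g - inner ℝ (gradient h y) g = ‖g‖ ^ 2 := by
    rw [← inner_sub_left, ← hg, real_inner_self_eq_norm_sq]
  have h4 : L⁻¹ * ‖g‖ ^ 2 - L / 2 * (L⁻¹ ^ 2 * ‖g‖ ^ 2) ≤
      h y - h x - inner ℝ (gradient h x) (y - x) := by
    rw [← h3, mul_sub, h3]; linarith
  have h5 : L⁻¹ * ‖g‖ ^ 2 - L / 2 * (L⁻¹ ^ 2 * ‖g‖ ^ 2) = ‖g‖ ^ 2 / (2 * L) := by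
    field_simp; ring
  rw [h5, div_le_iff₀ (by positivity)] at h4
  linarith

/-- The one-sidedness matters: two such errors lie in the same interval, so their difference is no
larger than a single error bound. -/
theorem linearization_error_bounds (hc : ConvexOn ℝ Set.univ h) (hd : Differentiable ℝ h)
    (hL : ∀ x y, ‖gradient h x - gradient h y‖ ≤ L * ‖x - y‖) (x v : E) :
    0 ≤ h (x + v) - h x - inner ℝ (gradient h x) v ∧
      h (x + v) - h x - inner ℝ (gradient h x) v ≤ L / 2 * ‖v‖ ^ 2 := by
  have h1 := add_inner_gradient_le hc hd x (x + v)
  have h2 := le_add_inner_gradient hd hL x (x + v)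
  rw [add_sub_cancel_left] at h1 h2
  constructor <;> linarith

theorem norm_gradient_le_growth (hL0 : 0 ≤ L)
    (hL : ∀ x y, ‖gradient h x - gradient h y‖ ≤ L * ‖x - y‖) (x : E) :
    ‖gradient h x‖ ≤ (‖gradient h 0‖ + L) * (1 + ‖x‖) := by
  have h1 := hL x 0
  have h2 := norm_le_norm_add_norm_sub' (gradient h x) (gradient h 0)
  rw [sub_zero] at h1
  nlinarith [norm_nonneg x, norm_nonneg (gradient h 0)]

theorem abs_le_growth (hc : ConvexOn ℝ Set.univ h) (hd : Differentiable ℝ h) (hL0 : 0 ≤ L)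
    (hL : ∀ x y, ‖gradient h x - gradient h y‖ ≤ L * ‖x - y‖) (x : E) :
    |h x| ≤ (|h 0| + ‖gradient h 0‖ + L) * (1 + ‖x‖) ^ 2 := by
  obtain ⟨h1, h2⟩ := linearization_error_bounds hc hd hL 0 x
  rw [zero_add] at h1 h2
  have h3 := abs_le.1 (abs_real_inner_le_norm (gradient h 0) x)
  have h4 := abs_le.1 (le_refl |h 0|)
  have h5 : |h x| ≤ |h 0| + ‖gradient h 0‖ * ‖x‖ + L / 2 * ‖x‖ ^ 2 := by
    rw [abs_le]
    have : 0 ≤ L / 2 * ‖x‖ ^ 2 := by positivity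
    constructor <;> linarith
  have : 0 ≤ ‖gradient h 0‖ := norm_nonneg _
  have : 0 ≤ |h 0| := abs_nonneg _
  have hx : 0 ≤ ‖x‖ := norm_nonneg x
  have e1 : 0 ≤ |h 0| * (2 * ‖x‖ + ‖x‖ ^ 2) := by positivity
  have e2 : 0 ≤ ‖gradient h 0‖ * (1 + ‖x‖ + ‖x‖ ^ 2) := by positivity
  have e3 : 0 ≤ L * (1 + 2 * ‖x‖ + ‖x‖ ^ 2 / 2) := by positivity
  nlinarith

theorem continuous_gradient (hL : ∀ x y, ‖gradient h x - gradient h y‖ ≤ L * ‖x - y‖) :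
    Continuous (gradient h) :=
  (LipschitzWith.of_dist_le' (K := L) fun x y => by
    simpa [dist_eq_norm] using hL x y).continuous

end SmoothConvex

/-! ### Gaussian integrability, Stein's identity and one-dimensional moments. -/

section Gaussian

variable {E : Type*} [NormedAddCommGroup E] [InnerProductSpace ℝ E] [FiniteDimensional ℝ E]
  [MeasurableSpace E] [BorelSpace E]

theorem integrable_one_add_norm_pow {F : Type*} [NormedAddCommGroup F] [NormedSpace ℝ F]
    [MeasurableSpace F] [BorelSpace F] [CompleteSpace F] [SecondCountableTopology F]
    (μ : Measure F) [IsGaussian μ] (m : ℕ) : Integrable (fun x => (1 + ‖x‖) ^ m) μ := by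
  have h := (memLp_const (1 : ℝ)).add (IsGaussian.memLp_id μ (m : ENNReal) (by simp)).norm
  have := h.integrable_norm_pow'
  refine this.congr (Filter.Eventually.of_forall fun x => ?_)
  simp only [Pi.add_apply, id, Real.norm_eq_abs]
  rw [abs_of_nonneg (by positivity)]

theorem integrable_of_growth {F G : Type*} [NormedAddCommGroup F] [NormedSpace ℝ F]
    [MeasurableSpace F] [BorelSpace F] [CompleteSpace F] [SecondCountableTopology F]
    [NormedAddCommGroup G]
    (μ : Measure F) [IsGaussian μ] {φ : F → G} (hφ : AEStronglyMeasurable φ μ) {K : ℝ} {m : ℕ}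
    (hK : ∀ x, ‖φ x‖ ≤ K * (1 + ‖x‖) ^ m) : Integrable φ μ :=
  ((integrable_one_add_norm_pow μ m).const_mul K).mono' hφ (Filter.Eventually.of_forall hK)

theorem integral_inner_mul_inner (a b : E) :
    ∫ u, inner ℝ a u * inner ℝ b u ∂(stdGaussian E) = inner ℝ a b := by
  have h := covarianceBilin_apply (IsGaussian.memLp_id (stdGaussian E) 2 (by simp)) a b
  rw [covarianceBilin_stdGaussian] at h
  simpa [innerSL_apply_apply ℝ] using h.symm

/-- Gaussian integration by parts (Stein's identity). -/
theorem integral_mul_inner_eq_integral_fderiv {φ : E → ℝ} {φ' : E → E →L[ℝ] ℝ}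
    (hφ : ∀ x, HasFDerivAt φ (φ' x) x) (hφ'c : Continuous φ') {K : ℝ} {k : ℕ}
    (hK : ∀ x, |φ x| ≤ K * (1 + ‖x‖) ^ k) (hK' : ∀ x, ‖φ' x‖ ≤ K * (1 + ‖x‖) ^ k) (a : E) :
    ∫ x, φ x * inner ℝ a x ∂(stdGaussian E) = ∫ x, φ' x a ∂(stdGaussian E) := by
  set μ := stdGaussian E with hμ
  have hφc : Continuous φ := continuous_iff_continuousAt.2 fun x => (hφ x).continuousAt
  have hK0 : 0 ≤ K := by simpa using (norm_nonneg _).trans (hK' 0)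
  -- A pair of independent Gaussians is rotated by θ, and S is the θ-derivative of R. The pair (R,
  -- S) keeps its law, so ∫ φ(R)⟨a, S⟩ is constant in θ and its derivative at 0 vanishes.
  let R : ℝ → E × E → E := fun θ p => Real.cos θ • p.1 + Real.sin θ • p.2
  let S : ℝ → E × E → E := fun θ p => -Real.sin θ • p.1 + Real.cos θ • p.2
  let F : ℝ → E × E → ℝ := fun θ p => φ (R θ p) * inner ℝ a (S θ p)
  let F' : ℝ → E × E → ℝ := fun θ p =>
    φ' (R θ p) (S θ p) * inner ℝ a (S θ p) + φ (R θ p) * inner ℝ a (-R θ p)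
  have hRn : ∀ θ p, ‖R θ p‖ ≤ 2 * ‖p‖ := by
    intro θ p
    refine (norm_add_le _ _).trans ?_
    rw [norm_smul, norm_smul, Real.norm_eq_abs, Real.norm_eq_abs]
    have := mul_le_mul (Real.abs_cos_le_one θ) (norm_fst_le p) (norm_nonneg _) zero_le_one
    have := mul_le_mul (Real.abs_sin_le_one θ) (norm_snd_le p) (norm_nonneg _) zero_le_one
    linarith
  have hSn : ∀ θ p, ‖S θ p‖ ≤ 2 * ‖p‖ := by
    intro θ p
    refine (norm_add_le _ _).trans ?_
    rw [norm_smul, norm_smul, norm_neg, Real.norm_eq_abs, Real.norm_eq_abs]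
    have := mul_le_mul (Real.abs_sin_le_one θ) (norm_fst_le p) (norm_nonneg _) zero_le_one
    have := mul_le_mul (Real.abs_cos_le_one θ) (norm_snd_le p) (norm_nonneg _) zero_le_one
    linarith
  have hpow : ∀ θ p, K * (1 + ‖R θ p‖) ^ k ≤ K * (2 * (1 + ‖p‖)) ^ k := by
    intro θ p
    gcongr
    have := hRn θ p
    linarith
  have hRcont : ∀ θ, Continuous (R θ) := fun θ => by fun_prop
  have hScont : ∀ θ, Continuous (S θ) := fun θ => by fun_prop
  have hFcont : ∀ θ, Continuous (F θ) := fun θ => by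
    have := hRcont θ; have := hScont θ; fun_prop
  have hF'cont : ∀ θ, Continuous (F' θ) := fun θ => by
    have := hRcont θ; have := hScont θ
    have h1 : Continuous fun p => φ' (R θ p) (S θ p) := (hφ'c.comp (hRcont θ)).clm_apply (hScont θ)
    have h2 : Continuous fun p => φ (R θ p) := hφc.comp (hRcont θ)
    exact (h1.mul (by fun_prop)).add (h2.mul (by fun_prop))
  have hFbound : ∀ θ p, ‖F θ p‖ ≤ (K * 2 ^ k * ‖a‖ * 2) * (1 + ‖p‖) ^ (k + 1) := by
    intro θ p
    simp only [F]
    rw [norm_mul, Real.norm_eq_abs]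
    calc |φ (R θ p)| * ‖(inner ℝ a (S θ p) : ℝ)‖
        ≤ (K * (2 * (1 + ‖p‖)) ^ k) * (‖a‖ * (2 * (1 + ‖p‖))) := by
          gcongr
          · exact (hK _).trans (hpow θ p)
          · refine (norm_inner_le_norm _ _).trans ?_
            gcongr
            have := hSn θ p
            linarith
      _ = _ := by rw [mul_pow]; ring
  have hF'bound : ∀ θ p, ‖F' θ p‖ ≤ (K * 2 ^ k * ‖a‖ * 6) * (1 + ‖p‖) ^ (k + 2) := by
    intro θ p
    have hp := norm_nonneg p
    have h1 : ‖φ' (R θ p) (S θ p) * inner ℝ a (S θ p)‖ ≤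
        (K * (2 * (1 + ‖p‖)) ^ k * (2 * (1 + ‖p‖))) * (‖a‖ * (2 * (1 + ‖p‖))) := by
      rw [norm_mul]
      have hs : ‖S θ p‖ ≤ 2 * (1 + ‖p‖) := by have := hSn θ p; linarith
      gcongr
      · refine ((φ' _).le_opNorm _).trans ?_
        gcongr
        exact (hK' _).trans (hpow θ p)
      · refine (norm_inner_le_norm _ _).trans ?_
        gcongr
    have h2 : ‖φ (R θ p) * inner ℝ a (-R θ p)‖ ≤
        (K * (2 * (1 + ‖p‖)) ^ k) * (‖a‖ * (2 * (1 + ‖p‖))) := by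
      rw [norm_mul, Real.norm_eq_abs]
      gcongr
      · exact (hK _).trans (hpow θ p)
      · refine (norm_inner_le_norm _ _).trans ?_
        rw [norm_neg]
        gcongr
        have := hRn θ p
        linarith
    have h3 : (K * (2 * (1 + ‖p‖)) ^ k) * (‖a‖ * (2 * (1 + ‖p‖))) ≤
        (K * (2 * (1 + ‖p‖)) ^ k) * (‖a‖ * (2 * (1 + ‖p‖) ^ 2)) := by
      gcongr
      nlinarith
    refine (norm_add_le _ _).trans ((add_le_add h1 (h2.trans h3)).trans (le_of_eq ?_))
    rw [mul_pow]; ring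
  have hderiv : ∀ p θ, HasDerivAt (fun θ => F θ p) (F' θ p) θ := by
    intro p θ
    have hR : HasDerivAt (fun θ => R θ p) (S θ p) θ :=
      ((Real.hasDerivAt_cos θ).smul_const p.1).add ((Real.hasDerivAt_sin θ).smul_const p.2)
    have hS : HasDerivAt (fun θ => S θ p) (-R θ p) θ := by
      refine ((((Real.hasDerivAt_sin θ).neg).smul_const p.1).add
        ((Real.hasDerivAt_cos θ).smul_const p.2)).congr_deriv ?_
      simp only [R]
      module
    exact ((hφ (R θ p)).comp_hasDerivAt θ hR).mul ((hasDerivAt_const θ a).inner ℝ hS |>.congr_deriv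
      (by simp))
  have hconst : ∀ θ, ∫ p, F θ p ∂(μ.prod μ) = ∫ p, F 0 p ∂(μ.prod μ) := by
    intro θ
    have hrot := IsGaussian.map_rotation_eq_self_of_forall_strongDual_eq_zero (μ := μ)
      (fun l => integral_strongDual_stdGaussian l) θ
    conv_rhs => rw [← hrot]
    rw [integral_map (by fun_prop) (hFcont 0).aestronglyMeasurable]
    refine integral_congr_ae (Filter.Eventually.of_forall fun p => ?_)
    simp [F, R, S, ContinuousLinearMap.rotation_apply]
  have hmain := hasDerivAt_integral_of_dominated_loc_of_deriv_le (μ := μ.prod μ) (F := F) (F' := F')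
    (x₀ := 0) (s := Set.univ) (bound := fun p => (K * 2 ^ k * ‖a‖ * 6) * (1 + ‖p‖) ^ (k + 2))
    Filter.univ_mem (Filter.Eventually.of_forall fun θ => (hFcont θ).aestronglyMeasurable)
    (integrable_of_growth _ (hFcont 0).aestronglyMeasurable (hFbound 0))
    (hF'cont 0).aestronglyMeasurable
    (Filter.Eventually.of_forall fun p θ _ => hF'bound θ p)
    ((integrable_one_add_norm_pow _ _).const_mul _)
    (Filter.Eventually.of_forall fun p θ _ => hderiv p θ)
  have hzero : ∫ p, F' 0 p ∂(μ.prod μ) = 0 := by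
    refine hmain.2.unique ?_
    rw [show (fun θ => ∫ p, F θ p ∂(μ.prod μ)) = fun _ => ∫ p, F 0 p ∂(μ.prod μ) from
      funext hconst]
    exact hasDerivAt_const _ _
  have hI1 : Integrable (fun x => φ' x a) μ := by
    refine integrable_of_growth μ (K := K * ‖a‖) (m := k)
      (hφ'c.clm_apply continuous_const).aestronglyMeasurable fun x => ?_
    refine ((φ' x).le_opNorm a).trans ?_
    nlinarith [hK' x, norm_nonneg a]
  have hI2 : Integrable (fun x => φ x * inner ℝ a x) μ := by
    refine integrable_of_growth μ (K := K * ‖a‖) (m := k + 1)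
      (by fun_prop) fun x => ?_
    rw [norm_mul, Real.norm_eq_abs]
    calc |φ x| * ‖(inner ℝ a x : ℝ)‖ ≤ (K * (1 + ‖x‖) ^ k) * (‖a‖ * (1 + ‖x‖)) := by
          gcongr
          · exact hK x
          · exact (norm_inner_le_norm _ _).trans (by gcongr; linarith)
      _ = _ := by ring
  rw [integral_prod _ hmain.1] at hzero
  -- At θ = 0 the second Gaussian y enters only through its covariance, which turns φ'(x)(y)⟨a, y⟩
  -- into φ'(x)(a).
  have hinner : ∀ x, ∫ y, F' 0 (x, y) ∂μ = φ' x a - φ x * inner ℝ a x := by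
    intro x
    have e : ∀ y, F' 0 (x, y) = inner ℝ ((InnerProductSpace.toDual ℝ E).symm (φ' x)) y *
        inner ℝ a y - φ x * inner ℝ a x := by
      intro y
      simp only [F', R, S, Real.cos_zero, Real.sin_zero, one_smul, zero_smul, add_zero, neg_zero,
        zero_add, inner_neg_right, InnerProductSpace.toDual_symm_apply]
      ring
    simp_rw [e]
    rw [integral_sub, integral_inner_mul_inner, InnerProductSpace.toDual_symm_apply]
    · simp
    · refine integrable_of_growth μ (K := ‖(InnerProductSpace.toDual ℝ E).symm (φ' x)‖ * ‖a‖)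
        (m := 2) (by fun_prop) fun y => ?_
      rw [norm_mul]
      calc _ ≤ (‖(InnerProductSpace.toDual ℝ E).symm (φ' x)‖ * (1 + ‖y‖)) * (‖a‖ * (1 + ‖y‖)) := by
            gcongr <;> exact (norm_inner_le_norm _ _).trans (by gcongr; linarith)
        _ = _ := by ring
    · exact integrable_const _
  simp_rw [hinner] at hzero
  rw [integral_sub hI1 hI2] at hzero
  linarith

theorem integrable_inner_pow (b : E) (k : ℕ) :
    Integrable (fun x => (inner ℝ b x) ^ k) (stdGaussian E) := by
  refine integrable_of_growth _ (K := ‖b‖ ^ k) (m := k) (by fun_prop) fun x => ?_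
  rw [norm_pow, ← mul_pow]
  gcongr
  exact (norm_inner_le_norm _ _).trans (by gcongr; linarith)

/-- Stein's identity for φ = ⟨b, ·⟩^(k+1) in the direction b. -/
theorem integral_inner_pow_add_two (b : E) (k : ℕ) :
    ∫ x, (inner ℝ b x) ^ (k + 2) ∂(stdGaussian E) =
      (k + 1) * ‖b‖ ^ 2 * ∫ x, (inner ℝ b x) ^ k ∂(stdGaussian E) := by
  have hd : ∀ x : E, HasFDerivAt (fun x => (inner ℝ b x) ^ (k + 1))
      (((k + 1 : ℝ) * (inner ℝ b x) ^ k) • innerSL ℝ b) x := by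
    intro x
    have h1 := (innerSL ℝ b).hasFDerivAt (x := x)
    have h2 := h1.pow (k + 1)
    simp only [innerSL_apply_apply, Nat.add_sub_cancel] at h2
    refine h2.congr_fderiv ?_
    ext v; simp
  have hin : ∀ x : E, |(inner ℝ b x : ℝ)| ≤ (1 + ‖b‖) * (1 + ‖x‖) := fun x =>
    (abs_real_inner_le_norm b x).trans (by gcongr <;> linarith)
  have hcalc := integral_mul_inner_eq_integral_fderiv (φ := fun x => (inner ℝ b x) ^ (k + 1))
    (K := (k + 1) * (1 + ‖b‖) ^ (k + 1)) (k := k + 1) hd (by fun_prop)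
    (fun x => by
      rw [abs_pow, mul_assoc, ← mul_pow]
      refine (pow_le_pow_left₀ (abs_nonneg _) (hin x) _).trans ?_
      exact le_mul_of_one_le_left (by positivity) (by linarith [(Nat.cast_nonneg k : (0 : ℝ) ≤ k)]))
    (fun x => by
      rw [norm_smul, norm_mul, norm_pow, innerSL_apply_norm, Real.norm_eq_abs, Real.norm_eq_abs,
        abs_of_nonneg (by positivity : (0 : ℝ) ≤ k + 1), mul_assoc, mul_assoc, ← mul_pow]
      gcongr
      rw [pow_succ]
      gcongr
      · exact hin x
      · nlinarith [norm_nonneg b, norm_nonneg x, mul_nonneg (norm_nonneg b) (norm_nonneg x)]) b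
  calc ∫ x, (inner ℝ b x) ^ (k + 2) ∂(stdGaussian E)
      = ∫ x, (inner ℝ b x) ^ (k + 1) * inner ℝ b x ∂(stdGaussian E) := by simp only [pow_succ]
    _ = ∫ x, ((k + 1) * ‖b‖ ^ 2) * (inner ℝ b x) ^ k ∂(stdGaussian E) := by
        rw [hcalc]
        refine integral_congr_ae (Filter.Eventually.of_forall fun x => ?_)
        simp only [smul_apply, innerSL_apply_apply, smul_eq_mul,
          real_inner_self_eq_norm_sq]
        ring
    _ = _ := integral_const_mul _ _

theorem integral_inner_sq (b : E) : ∫ x, (inner ℝ b x) ^ 2 ∂(stdGaussian E) = ‖b‖ ^ 2 := by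
  simpa using integral_inner_pow_add_two b 0

theorem integral_inner_pow_four (b : E) :
    ∫ x, (inner ℝ b x) ^ 4 ∂(stdGaussian E) = 3 * ‖b‖ ^ 4 := by
  rw [integral_inner_pow_add_two b 2, integral_inner_sq]
  push_cast; ring

theorem integral_inner_pow_six (b : E) :
    ∫ x, (inner ℝ b x) ^ 6 ∂(stdGaussian E) = 15 * ‖b‖ ^ 6 := by
  rw [integral_inner_pow_add_two b 4, integral_inner_pow_four]
  push_cast; ring

end Gaussian

/-! ### Moments of the norm in ℝ^d. -/

section Coordinates

variable {d : ℕ}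

theorem integral_norm_sq_stdGaussian : ∫ u, ‖u‖ ^ 2 ∂(stdGaussian (Vec d)) = d := by
  have h : ∀ u : Vec d, ‖u‖ ^ 2 = ∑ j, (inner ℝ (EuclideanSpace.single j (1 : ℝ)) u) ^ 2 := by
    intro u
    rw [EuclideanSpace.real_norm_sq_eq]
    simp [EuclideanSpace.inner_single_left]
  simp_rw [h]
  rw [integral_finsetSum _ fun j _ => integrable_inner_pow _ _]
  simp [integral_inner_sq]

/-- The power mean inequality gives ‖u‖⁶ ≤ d² ∑ u_j⁶, and each coordinate has sixth moment 15. -/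
theorem integral_norm_pow_six_le : ∫ u, ‖u‖ ^ 6 ∂(stdGaussian (Vec d)) ≤ 15 * (d : ℝ) ^ 3 := by
  have h : ∀ u : Vec d, ‖u‖ ^ 6 ≤
      ∑ j, (d : ℝ) ^ 2 * (inner ℝ (EuclideanSpace.single j (1 : ℝ)) u) ^ 6 := by
    intro u
    have h1 : ‖u‖ ^ 6 = (∑ j, (u j) ^ 2) ^ 3 := by
      rw [← EuclideanSpace.real_norm_sq_eq]; ring
    have h3 : (∑ j, (u j) ^ 2) ^ 3 ≤ (d : ℝ) ^ 2 * ∑ j, ((u j) ^ 2) ^ 3 := by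
      have := pow_sum_le_card_mul_sum_pow (s := Finset.univ) (f := fun j => (u j) ^ 2)
        (fun j _ => sq_nonneg _) 2
      simpa using this
    rw [h1, ← Finset.mul_sum]
    refine h3.trans (le_of_eq ?_)
    simp [EuclideanSpace.inner_single_left, ← pow_mul]
  have hint : ∀ j : Fin d, Integrable (fun u : Vec d =>
      (d : ℝ) ^ 2 * (inner ℝ (EuclideanSpace.single j (1 : ℝ)) u) ^ 6) (stdGaussian (Vec d)) :=
    fun j => (integrable_inner_pow _ _).const_mul _
  refine (integral_mono_of_nonneg (Filter.Eventually.of_forall fun u => by positivity)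
    (integrable_finsetSum _ fun j _ => hint j) (Filter.Eventually.of_forall h)).trans ?_
  rw [integral_finsetSum _ fun j _ => hint j]
  simp only [integral_const_mul, integral_inner_pow_six]
  simp
  apply le_of_eq; ring

/-- AM–GM in each coordinate, balanced by s = ‖a‖² so that both fourth moments contribute 3s/2. -/
theorem integral_inner_sq_mul_norm_sq_le (a : Vec d) :
    ∫ u, (inner ℝ a u) ^ 2 * ‖u‖ ^ 2 ∂(stdGaussian (Vec d)) ≤ 3 * d * ‖a‖ ^ 2 := by
  rcases eq_or_ne a 0 with rfl | ha
  · simp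
  have hs : 0 < ‖a‖ ^ 2 := by positivity
  set s := ‖a‖ ^ 2 with hsdef
  have h : ∀ u : Vec d, (inner ℝ a u) ^ 2 * ‖u‖ ^ 2 ≤
      ∑ j, ((1 / (2 * s)) * (inner ℝ a u) ^ 4 +
        (s / 2) * (inner ℝ (EuclideanSpace.single j (1 : ℝ)) u) ^ 4) := by
    intro u
    rw [EuclideanSpace.real_norm_sq_eq, Finset.mul_sum]
    refine Finset.sum_le_sum fun j _ => ?_
    simp only [EuclideanSpace.inner_single_left, map_one, one_mul]
    have : (1 / (2 * s)) * (inner ℝ a u) ^ 4 + (s / 2) * (u j) ^ 4 -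
        (inner ℝ a u) ^ 2 * (u j) ^ 2 = (1 / (2 * s)) * ((inner ℝ a u) ^ 2 - s * (u j) ^ 2) ^ 2 := by
      field_simp; ring
    have : 0 ≤ (1 / (2 * s)) * ((inner ℝ a u) ^ 2 - s * (u j) ^ 2) ^ 2 := by positivity
    linarith
  have hint : ∀ j : Fin d, Integrable (fun u : Vec d => (1 / (2 * s)) * (inner ℝ a u) ^ 4 +
        (s / 2) * (inner ℝ (EuclideanSpace.single j (1 : ℝ)) u) ^ 4) (stdGaussian (Vec d)) :=
    fun j => ((integrable_inner_pow _ _).const_mul _).add ((integrable_inner_pow _ _).const_mul _)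
  refine (integral_mono_of_nonneg (Filter.Eventually.of_forall fun u => by positivity)
    (integrable_finsetSum _ fun j _ => hint j) (Filter.Eventually.of_forall h)).trans ?_
  rw [integral_finsetSum _ fun j _ => hint j]
  simp_rw [fun j : Fin d => integral_add ((integrable_inner_pow a 4).const_mul (1 / (2 * s)))
    ((integrable_inner_pow (EuclideanSpace.single j (1 : ℝ)) 4).const_mul (s / 2)),
    integral_const_mul, integral_inner_pow_four]
  rw [show ‖a‖ ^ 4 = s ^ 2 by rw [hsdef]; ring]
  simp
  apply le_of_eq; field_simp; ring

end Coordinates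

/-! ### Gaussian smoothing: convexity, smoothness, and bias and variance of the estimators. -/

variable {d n : ℕ}

/-- A convex differentiable function with `L`-Lipschitz gradient. -/
structure IsConvexSmooth (h : Vec d → ℝ) (L : ℝ) : Prop where
  convex : ConvexOn ℝ Set.univ h
  differentiable : Differentiable ℝ h
  smooth : ∀ x y, ‖gradient h x - gradient h y‖ ≤ L * ‖x - y‖

/-- The gradient of the Gaussian smoothing, `E_u[∇h(x + μ u)]`. -/
def smoothGrad (h : Vec d → ℝ) (μ : ℝ) (x : Vec d) : Vec d :=
  ∫ u, gradient h (x + μ • u) ∂(stdGaussian (Vec d))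

theorem one_add_norm_add_smul_le (μ : ℝ) (x u : Vec d) :
    1 + ‖x + μ • u‖ ≤ (1 + ‖x‖ + |μ|) * (1 + ‖u‖) := by
  have h1 := norm_add_le x (μ • u)
  rw [norm_smul, Real.norm_eq_abs] at h1
  have h2 := mul_nonneg (norm_nonneg x) (norm_nonneg u)
  nlinarith [norm_nonneg x, norm_nonneg u, abs_nonneg μ]

namespace IsConvexSmooth

variable {h : Vec d → ℝ} {L μ : ℝ}

theorem continuous (hh : IsConvexSmooth h L) : Continuous h := hh.differentiable.continuous

theorem continuous_gradient (hh : IsConvexSmooth h L) : Continuous (gradient h) :=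
  ZOVarag.continuous_gradient hh.smooth

theorem integrable_comp (hh : IsConvexSmooth h L) (hL : 0 ≤ L) (μ : ℝ) (x : Vec d) :
    Integrable (fun u => h (x + μ • u)) (stdGaussian (Vec d)) := by
  have hc := hh.continuous
  refine integrable_of_growth _ (K := (|h 0| + ‖gradient h 0‖ + L) * (1 + ‖x‖ + |μ|) ^ 2) (m := 2)
    (Continuous.aestronglyMeasurable (by fun_prop)) fun u => ?_
  refine (abs_le_growth hh.convex hh.differentiable hL hh.smooth _).trans ?_
  rw [mul_assoc, ← mul_pow]
  gcongr
  exact one_add_norm_add_smul_le μ x u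

theorem integrable_gradient_comp (hh : IsConvexSmooth h L) (hL : 0 ≤ L) (μ : ℝ) (x : Vec d) :
    Integrable (fun u => gradient h (x + μ • u)) (stdGaussian (Vec d)) := by
  have hc := hh.continuous_gradient
  refine integrable_of_growth _ (K := (‖gradient h 0‖ + L) * (1 + ‖x‖ + |μ|)) (m := 1)
    (Continuous.aestronglyMeasurable (by fun_prop)) fun u => ?_
  refine (norm_gradient_le_growth hL hh.smooth _).trans ?_
  rw [pow_one, mul_assoc]
  gcongr
  exact one_add_norm_add_smul_le μ x u

theorem integrable_inner_gradient_comp (hh : IsConvexSmooth h L) (hL : 0 ≤ L) (μ : ℝ)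
    (x v : Vec d) :
    Integrable (fun u => inner ℝ (gradient h (x + μ • u)) v) (stdGaussian (Vec d)) :=
  (hh.integrable_gradient_comp hL μ x).inner_const v

theorem inner_smoothGrad (hh : IsConvexSmooth h L) (hL : 0 ≤ L) (x v : Vec d) :
    inner ℝ (smoothGrad h μ x) v =
      ∫ u, inner ℝ (gradient h (x + μ • u)) v ∂(stdGaussian (Vec d)) := by
  rw [real_inner_comm, smoothGrad, ← integral_inner (hh.integrable_gradient_comp hL μ x)]
  simp_rw [real_inner_comm]

/-- The Bregman divergence of the smoothing is the average of those of the translates. -/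
theorem smoothed_bregman (hh : IsConvexSmooth h L) (hL : 0 ≤ L) (x y : Vec d) :
    smoothed h μ y - smoothed h μ x - inner ℝ (smoothGrad h μ x) (y - x) =
      ∫ u, (h (y + μ • u) - h (x + μ • u) - inner ℝ (gradient h (x + μ • u)) (y - x))
        ∂(stdGaussian (Vec d)) := by
  have hI : Integrable (fun u => h (y + μ • u) - h (x + μ • u)) (stdGaussian (Vec d)) :=
    (hh.integrable_comp hL μ y).sub (hh.integrable_comp hL μ x)
  rw [integral_sub hI (hh.integrable_inner_gradient_comp hL μ x _), integral_sub (hh.integrable_comp hL μ y) (hh.integrable_comp hL μ x),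
    hh.inner_smoothGrad hL, smoothed, smoothed]

theorem integrable_bregman (hh : IsConvexSmooth h L) (hL : 0 ≤ L) (μ : ℝ) (x y : Vec d) :
    Integrable (fun u => h (y + μ • u) - h (x + μ • u) - inner ℝ (gradient h (x + μ • u)) (y - x))
        (stdGaussian (Vec d)) :=
  ((hh.integrable_comp hL μ y).sub (hh.integrable_comp hL μ x)).sub
    (hh.integrable_inner_gradient_comp hL μ x _)

/-- This bound and `smoothed_le` carry all the first-order information on f_μ: the corresponding
inequalities for h are integrated over the translates. -/
theorem smoothed_ge (hh : IsConvexSmooth h L) (hL : 0 ≤ L) (x y : Vec d) :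
    smoothed h μ x + inner ℝ (smoothGrad h μ x) (y - x) ≤ smoothed h μ y := by
  have : 0 ≤ smoothed h μ y - smoothed h μ x - inner ℝ (smoothGrad h μ x) (y - x) := by
    rw [hh.smoothed_bregman hL]
    refine integral_nonneg fun u => ?_
    have := add_inner_gradient_le hh.convex hh.differentiable (x + μ • u) (y + μ • u)
    rw [add_sub_add_right_eq_sub] at this
    simp only [Pi.zero_apply]
    linarith
  linarith

theorem smoothed_le (hh : IsConvexSmooth h L) (hL : 0 ≤ L) (x y : Vec d) :
    smoothed h μ y ≤ smoothed h μ x + inner ℝ (smoothGrad h μ x) (y - x)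
      + L / 2 * ‖y - x‖ ^ 2 := by
  have : smoothed h μ y - smoothed h μ x - inner ℝ (smoothGrad h μ x) (y - x)
      ≤ L / 2 * ‖y - x‖ ^ 2 := by
    rw [hh.smoothed_bregman hL]
    refine (integral_mono (hh.integrable_bregman hL μ x y)
      (integrable_const (L / 2 * ‖y - x‖ ^ 2)) fun u => ?_).trans (by simp)
    have := le_add_inner_gradient hh.differentiable hh.smooth (x + μ • u) (y + μ • u)
    rw [add_sub_add_right_eq_sub] at this
    linarith
  linarith

theorem norm_smoothGrad_sub_le (hh : IsConvexSmooth h L) (hL : 0 ≤ L) (x y : Vec d) :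
    ‖smoothGrad h μ x - smoothGrad h μ y‖ ≤ L * ‖x - y‖ := by
  rw [smoothGrad, smoothGrad, ← integral_sub (hh.integrable_gradient_comp hL μ x)
    (hh.integrable_gradient_comp hL μ y)]
  refine (norm_integral_le_of_norm_le_const (C := L * ‖x - y‖)
    (Filter.Eventually.of_forall fun u => ?_)).trans (by simp)
  simpa using hh.smooth (x + μ • u) (y + μ • u)

theorem continuous_smoothGrad (hh : IsConvexSmooth h L) (hL : 0 ≤ L) :
    Continuous (smoothGrad h μ) :=
  (LipschitzWith.of_dist_le' (K := L) fun x y => by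
    simpa [dist_eq_norm] using hh.norm_smoothGrad_sub_le (μ := μ) hL x y).continuous

theorem abs_smoothed_le_growth (hh : IsConvexSmooth h L) (hL : 0 ≤ L) (x : Vec d) :
    |smoothed h μ x| ≤
      (|smoothed h μ 0| + ‖smoothGrad h μ 0‖ + L) * (1 + ‖x‖) ^ 2 := by
  have h1 := hh.smoothed_ge (μ := μ) hL 0 x
  have h2 := hh.smoothed_le (μ := μ) hL 0 x
  rw [sub_zero] at h1 h2
  have h3 := abs_le.1 (abs_real_inner_le_norm (smoothGrad h μ 0) x)
  have h4 := abs_le.1 (le_refl |smoothed h μ 0|)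
  have h5 : |smoothed h μ x| ≤ |smoothed h μ 0| + ‖smoothGrad h μ 0‖ * ‖x‖ + L / 2 * ‖x‖ ^ 2 := by
    rw [abs_le]
    have : 0 ≤ L / 2 * ‖x‖ ^ 2 := by positivity
    constructor <;> linarith
  have : 0 ≤ ‖smoothGrad h μ 0‖ := norm_nonneg _
  have : 0 ≤ |smoothed h μ 0| := abs_nonneg _
  have hx : 0 ≤ ‖x‖ := norm_nonneg x
  have e1 : 0 ≤ |smoothed h μ 0| * (2 * ‖x‖ + ‖x‖ ^ 2) := by positivity
  have e2 : 0 ≤ ‖smoothGrad h μ 0‖ * (1 + ‖x‖ + ‖x‖ ^ 2) := by positivity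
  have e3 : 0 ≤ L * (1 + 2 * ‖x‖ + ‖x‖ ^ 2 / 2) := by positivity
  nlinarith

/-- A squeeze between the affine minorant and the quadratic majorant that touch at x. -/
theorem continuous_smoothed (hh : IsConvexSmooth h L) (hL : 0 ≤ L) :
    Continuous (smoothed h μ) := by
  rw [continuous_iff_continuousAt]
  intro x
  have h1 : Filter.Tendsto (fun y => smoothed h μ x + inner ℝ (smoothGrad h μ x) (y - x))
      (nhds x) (nhds (smoothed h μ x)) := by
    have : Continuous fun y => smoothed h μ x + inner ℝ (smoothGrad h μ x) (y - x) := by fun_prop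
    simpa using this.tendsto x
  have h2 : Filter.Tendsto (fun y => smoothed h μ x + inner ℝ (smoothGrad h μ x) (y - x)
      + L / 2 * ‖y - x‖ ^ 2) (nhds x) (nhds (smoothed h μ x)) := by
    have : Continuous fun y => smoothed h μ x + inner ℝ (smoothGrad h μ x) (y - x)
      + L / 2 * ‖y - x‖ ^ 2 := by fun_prop
    simpa using this.tendsto x
  exact tendsto_of_tendsto_of_tendsto_of_le_of_le h1 h2 (fun y => hh.smoothed_ge hL x y)
    (fun y => hh.smoothed_le hL x y)

theorem convexOn_smoothed (hh : IsConvexSmooth h L) (hL : 0 ≤ L) :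
    ConvexOn ℝ Set.univ (smoothed h μ) := by
  refine ⟨convex_univ, fun x _ y _ a b ha hb hab => ?_⟩
  have h1 := hh.smoothed_ge (μ := μ) hL (a • x + b • y) x
  have h2 := hh.smoothed_ge (μ := μ) hL (a • x + b • y) y
  set g := smoothGrad h μ (a • x + b • y)
  have h3 : a * inner ℝ g (x - (a • x + b • y)) + b * inner ℝ g (y - (a • x + b • y)) = 0 := by
    rw [← inner_smul_right, ← inner_smul_right, ← inner_add_right,
      show a • (x - (a • x + b • y)) + b • (y - (a • x + b • y)) = (0 : Vec d) by
        obtain rfl : b = 1 - a := by linarith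
        module, inner_zero_right]
  have h4 := mul_le_mul_of_nonneg_left h1 ha
  have h5 := mul_le_mul_of_nonneg_left h2 hb
  have h6 : smoothed h μ (a • x + b • y) = a * smoothed h μ (a • x + b • y) +
    b * smoothed h μ (a • x + b • y) := by rw [← add_mul, hab, one_mul]
  simp only [smul_eq_mul]
  linarith

theorem norm_gaussEst_le (hh : IsConvexSmooth h L) (hL : 0 ≤ L) (hμ : 0 < μ) (x u : Vec d) :
    ‖gaussEst h μ x u‖ ≤ (‖gradient h 0‖ + L + L * μ) * (1 + ‖x‖) * (1 + ‖u‖) ^ 3 := by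
  obtain ⟨h1, h2⟩ := linearization_error_bounds hh.convex hh.differentiable hh.smooth x (μ • u)
  have h3 := abs_le.1 (abs_real_inner_le_norm (gradient h x) (μ • u))
  rw [norm_smul, Real.norm_of_nonneg hμ.le] at h2 h3
  have h4 := norm_gradient_le_growth hL hh.smooth x
  have hu := norm_nonneg u
  have hx := norm_nonneg x
  have hg := norm_nonneg (gradient h 0)
  have h5 : |h (x + μ • u) - h x| ≤ ‖gradient h x‖ * (μ * ‖u‖) + L / 2 * (μ * ‖u‖) ^ 2 := by
    rw [abs_le]
    have : 0 ≤ L / 2 * (μ * ‖u‖) ^ 2 := by positivity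
    constructor <;> linarith
  rw [gaussEst, norm_smul, Real.norm_eq_abs, abs_div, abs_of_pos hμ]
  calc |h (x + μ • u) - h x| / μ * ‖u‖
      ≤ (‖gradient h x‖ * (μ * ‖u‖) + L / 2 * (μ * ‖u‖) ^ 2) / μ * ‖u‖ := by gcongr
    _ = ‖gradient h x‖ * ‖u‖ ^ 2 + L * μ / 2 * ‖u‖ ^ 3 := by field_simp
    _ ≤ ((‖gradient h 0‖ + L) * (1 + ‖x‖)) * (1 + ‖u‖) ^ 3 +
        (L * μ * (1 + ‖x‖)) * (1 + ‖u‖) ^ 3 := by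
        gcongr
        · nlinarith [pow_nonneg hu 3]
        · have : 0 ≤ L * μ := by positivity
          nlinarith
        · linarith
    _ = _ := by ring

theorem continuous_gaussEst (hh : IsConvexSmooth h L) :
    Continuous (Function.uncurry (gaussEst h μ)) := by
  have := hh.continuous
  unfold gaussEst Function.uncurry
  fun_prop

theorem integrable_gaussEst (hh : IsConvexSmooth h L) (hL : 0 ≤ L) (hμ : 0 < μ) (x : Vec d) :
    Integrable (gaussEst h μ x) (stdGaussian (Vec d)) :=
  integrable_of_growth _ (by have := hh.continuous_gaussEst (μ := μ); fun_prop)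
    (hh.norm_gaussEst_le hL hμ x)

/-- The two-point estimator is an unbiased estimator of the gradient of the smoothing. -/
theorem integral_gaussEst (hh : IsConvexSmooth h L) (hL : 0 ≤ L) (hμ : 0 < μ) (x : Vec d) :
    ∫ u, gaussEst h μ x u ∂(stdGaussian (Vec d)) = smoothGrad h μ x := by
  refine ext_inner_right ℝ fun v => ?_
  have hc := hh.continuous_gradient
  rw [hh.inner_smoothGrad hL, real_inner_comm, ← integral_inner (hh.integrable_gaussEst hL hμ x)]
  -- Stein's identity is applied to the difference quotient as a function of u; the factor μ from
  -- the chain rule cancels the denominator.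
  have hd : ∀ u : Vec d, HasFDerivAt (fun u => (h (x + μ • u) - h x) / μ)
      (innerSL ℝ (gradient h (x + μ • u))) u := by
    intro u
    have h1 : HasFDerivAt (fun u : Vec d => x + μ • u) (μ • ContinuousLinearMap.id ℝ (Vec d)) u :=
      ((hasFDerivAt_id u).const_smul μ).const_add x
    have h2 := ((hh.differentiable (x + μ • u)).hasFDerivAt.comp u h1).sub_const (h x)
    have h3 := h2.mul_const μ⁻¹
    simp only [← div_eq_mul_inv] at h3
    refine h3.congr_fderiv ?_
    ext w
    simp [hμ.ne']
  set K : ℝ := ((|h 0| + ‖gradient h 0‖ + L) * (1 + ‖x‖ + |μ|) ^ 2 + |h x|) / μ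
    + (‖gradient h 0‖ + L) * (1 + ‖x‖ + |μ|) with hKdef
  have hp1 : 0 ≤ ((|h 0| + ‖gradient h 0‖ + L) * (1 + ‖x‖ + |μ|) ^ 2 + |h x|) / μ := by positivity
  have hp2 : 0 ≤ (‖gradient h 0‖ + L) * (1 + ‖x‖ + |μ|) := by positivity
  have key := integral_mul_inner_eq_integral_fderiv hd
    ((innerSL ℝ).continuous.comp (by fun_prop)) (K := K) (k := 2)
    (fun u => by
      have h1 := abs_le_growth hh.convex hh.differentiable hL hh.smooth (x + μ • u)
      have h2 : (1 + ‖x + μ • u‖) ^ 2 ≤ ((1 + ‖x‖ + |μ|) * (1 + ‖u‖)) ^ 2 := by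
        gcongr; exact one_add_norm_add_smul_le μ x u
      have hu : 1 ≤ (1 + ‖u‖) ^ 2 := one_le_pow₀ (by linarith [norm_nonneg u])
      rw [abs_div, abs_of_pos hμ]
      calc |h (x + μ • u) - h x| / μ ≤ (|h (x + μ • u)| + |h x|) / μ := by
            gcongr; exact abs_sub _ _
        _ ≤ ((|h 0| + ‖gradient h 0‖ + L) * ((1 + ‖x‖ + |μ|) * (1 + ‖u‖)) ^ 2
            + |h x| * (1 + ‖u‖) ^ 2) / μ := by
            gcongr
            · exact h1.trans (by gcongr)
            · exact le_mul_of_one_le_right (abs_nonneg _) hu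
        _ = (((|h 0| + ‖gradient h 0‖ + L) * (1 + ‖x‖ + |μ|) ^ 2 + |h x|) / μ)
            * (1 + ‖u‖) ^ 2 := by ring
        _ ≤ _ := by gcongr; linarith)
    (fun u => by
      rw [innerSL_apply_norm]
      refine (norm_gradient_le_growth hL hh.smooth _).trans ?_
      calc (‖gradient h 0‖ + L) * (1 + ‖x + μ • u‖)
          ≤ (‖gradient h 0‖ + L) * ((1 + ‖x‖ + |μ|) * (1 + ‖u‖)) := by
            gcongr; exact one_add_norm_add_smul_le μ x u
        _ = ((‖gradient h 0‖ + L) * (1 + ‖x‖ + |μ|)) * (1 + ‖u‖) := by ring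
        _ ≤ K * (1 + ‖u‖) ^ 2 := by
            gcongr
            · linarith
            · nlinarith [norm_nonneg u]) v
  simp only [innerSL_apply_apply] at key
  rw [← key]
  refine integral_congr_ae (Filter.Eventually.of_forall fun u => ?_)
  simp [gaussEst, inner_smul_right]

/-- The Lipschitz bound under the integral gives L|μ| E‖u‖, and (E‖u‖)² ≤ E‖u‖² = d because the
variance of ‖u‖ is nonnegative. -/
theorem norm_sq_smoothGrad_sub_gradient_le (hh : IsConvexSmooth h L) (hL : 0 ≤ L) (x : Vec d) :
    ‖smoothGrad h μ x - gradient h x‖ ^ 2 ≤ L ^ 2 * μ ^ 2 * d := by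
  have hn : Integrable (fun u : Vec d => ‖u‖) (stdGaussian (Vec d)) :=
    integrable_of_growth _ (K := 1) (m := 1) (by fun_prop) fun u => by simp
  have hn2 : Integrable (fun u : Vec d => ‖u‖ ^ 2) (stdGaussian (Vec d)) :=
    integrable_of_growth _ (K := 1) (m := 2) (by fun_prop) fun u => by
      simp only [norm_pow, norm_norm, one_mul]; gcongr; linarith
  set c := ∫ u, ‖u‖ ∂(stdGaussian (Vec d)) with hc
  have hc2 : c ^ 2 ≤ d := by
    have h0 : 0 ≤ ∫ u, (‖u‖ - c) ^ 2 ∂(stdGaussian (Vec d)) := integral_nonneg fun u => sq_nonneg _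
    have e : ∀ u : Vec d, (‖u‖ - c) ^ 2 = ‖u‖ ^ 2 - 2 * c * ‖u‖ + c ^ 2 := fun u => by ring
    simp_rw [e] at h0
    have hI : Integrable (fun u : Vec d => ‖u‖ ^ 2 - 2 * c * ‖u‖) (stdGaussian (Vec d)) :=
      hn2.sub (hn.const_mul _)
    rw [integral_add hI (integrable_const _),
      integral_sub hn2 (hn.const_mul _), integral_const_mul, integral_norm_sq_stdGaussian,
      ← hc] at h0
    simp at h0
    nlinarith
  have h1 : ‖smoothGrad h μ x - gradient h x‖ ≤ L * |μ| * c := by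
    have e : smoothGrad h μ x - gradient h x =
        ∫ u, (gradient h (x + μ • u) - gradient h x) ∂(stdGaussian (Vec d)) := by
      rw [integral_sub (hh.integrable_gradient_comp hL μ x) (integrable_const _)]
      simp [smoothGrad]
    rw [e, hc, ← integral_const_mul]
    refine norm_integral_le_of_norm_le (hn.const_mul _) (Filter.Eventually.of_forall fun u => ?_)
    refine (hh.smooth _ _).trans (le_of_eq ?_)
    simp [norm_smul, mul_assoc]
  calc ‖smoothGrad h μ x - gradient h x‖ ^ 2 ≤ (L * |μ| * c) ^ 2 := by gcongr
    _ = L ^ 2 * μ ^ 2 * c ^ 2 := by rw [mul_pow, mul_pow, sq_abs]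
    _ ≤ _ := by gcongr

theorem norm_sq_coordEst_sub_gradient_le (hh : IsConvexSmooth h L) {ν : ℝ} (hν : 0 < ν)
    (x : Vec d) :
    ‖coordEst h ν x - gradient h x‖ ^ 2 ≤ L ^ 2 * ν ^ 2 * d := by
  rw [EuclideanSpace.real_norm_sq_eq]
  have hj : ∀ j : Fin d, ((coordEst h ν x - gradient h x) j) ^ 2 ≤ L ^ 2 * ν ^ 2 := by
    intro j
    set e : Vec d := EuclideanSpace.single j (1 : ℝ) with he
    have e1 : coordEst h ν x j = (h (x + ν • e) - h (x - ν • e)) / (2 * ν) := by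
      simp [coordEst, he, Pi.single_apply]
    have e2 : gradient h x j = inner ℝ (gradient h x) e := by
      simp [he, EuclideanSpace.inner_single_right, -inner_gradient_left]
    obtain ⟨a1, a2⟩ := linearization_error_bounds hh.convex hh.differentiable hh.smooth x (ν • e)
    obtain ⟨b1, b2⟩ := linearization_error_bounds hh.convex hh.differentiable hh.smooth x
      (-(ν • e))
    have hne : ‖ν • e‖ ^ 2 = ν ^ 2 := by simp [norm_smul, he]
    rw [norm_neg] at b2
    rw [hne] at a2 b2
    rw [inner_smul_right, ← e2] at a1 a2
    rw [inner_neg_right, inner_smul_right, ← e2, ← sub_eq_add_neg] at b1 b2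
    have hL0 : 0 ≤ L * ν ^ 2 := by linarith
    have h3 : |(coordEst h ν x - gradient h x) j| ≤ L * ν := by
      rw [PiLp.sub_apply, e1, abs_le]
      constructor
      · rw [le_sub_iff_add_le, le_div_iff₀ (by positivity)]; nlinarith
      · rw [sub_le_iff_le_add, div_le_iff₀ (by positivity)]; nlinarith
    rw [← sq_abs, ← mul_pow]
    gcongr
  refine (Finset.sum_le_sum fun j _ => hj j).trans (le_of_eq ?_)
  simp; ring

/-- The estimator difference is (⟨a, u⟩ + r)u, with a the gradient difference and r a second-order
remainder. The main term is controlled by ‖a‖², and cocoercivity at the translates bounds ‖a‖² by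
the Bregman gap of the smoothing. -/
theorem integral_norm_sq_gaussEst_sub_le (hh : IsConvexSmooth h L) (hL : 0 < L) (hμ : 0 < μ)
    (q p : Vec d) :
    ∫ u, ‖gaussEst h μ q u - gaussEst h μ p u‖ ^ 2 ∂(stdGaussian (Vec d)) ≤
      12 * d * L * (smoothed h μ p - smoothed h μ q - inner ℝ (smoothGrad h μ q) (p - q))
        + 72 * L ^ 2 * μ ^ 2 * d ^ 2 + 45 / 4 * μ ^ 2 * L ^ 2 * d ^ 3 := by
  set a := gradient h q - gradient h p with ha
  have hn2 : Integrable (fun u : Vec d => ‖u‖ ^ 2) (stdGaussian (Vec d)) :=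
    integrable_of_growth _ (K := 1) (m := 2) (by fun_prop) fun u => by
      simp only [norm_pow, norm_norm, one_mul]; gcongr; linarith
  have hn6 : Integrable (fun u : Vec d => ‖u‖ ^ 6) (stdGaussian (Vec d)) :=
    integrable_of_growth _ (K := 1) (m := 6) (by fun_prop) fun u => by
      simp only [norm_pow, norm_norm, one_mul]; gcongr; linarith
  have han : Integrable (fun u : Vec d => (inner ℝ a u) ^ 2 * ‖u‖ ^ 2) (stdGaussian (Vec d)) :=
    integrable_of_growth _ (K := ‖a‖ ^ 2) (m := 4) (by fun_prop) fun u => by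
      rw [norm_mul, norm_pow, norm_pow, norm_norm]
      calc ‖(inner ℝ a u : ℝ)‖ ^ 2 * ‖u‖ ^ 2 ≤ (‖a‖ * ‖u‖) ^ 2 * ‖u‖ ^ 2 := by
            gcongr; exact norm_inner_le_norm _ _
        _ = ‖a‖ ^ 2 * ‖u‖ ^ 4 := by ring
        _ ≤ _ := by gcongr; linarith
  have hpt : ∀ u, ‖gaussEst h μ q u - gaussEst h μ p u‖ ^ 2 ≤
      3 / 2 * ((inner ℝ a u) ^ 2 * ‖u‖ ^ 2) + 3 * (μ * L / 2) ^ 2 * ‖u‖ ^ 6 := by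
    intro u
    obtain ⟨a1, a2⟩ := linearization_error_bounds hh.convex hh.differentiable hh.smooth q (μ • u)
    obtain ⟨b1, b2⟩ := linearization_error_bounds hh.convex hh.differentiable hh.smooth p (μ • u)
    have hm : ‖μ • u‖ ^ 2 = μ ^ 2 * ‖u‖ ^ 2 := by rw [norm_smul, mul_pow]; simp
    rw [hm, inner_smul_right] at a2 b2
    rw [inner_smul_right] at a1 b1
    set r := (h (q + μ • u) - h q) / μ - (h (p + μ • u) - h p) / μ - inner ℝ a u with hr
    have hrb : |r| ≤ μ * L / 2 * ‖u‖ ^ 2 := by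
      have e : r = ((h (q + μ • u) - h q - μ * inner ℝ (gradient h q) u) -
          (h (p + μ • u) - h p - μ * inner ℝ (gradient h p) u)) / μ := by
        rw [hr, ha, inner_sub_left]; field_simp; ring
      rw [e, abs_div, abs_of_pos hμ, div_le_iff₀ hμ, abs_le]
      constructor <;> nlinarith
    have e : gaussEst h μ q u - gaussEst h μ p u = (inner ℝ a u + r) • u := by
      rw [hr, gaussEst, gaussEst, ← sub_smul]; congr 1; ring
    have hr2 : r ^ 2 ≤ (μ * L / 2 * ‖u‖ ^ 2) ^ 2 := by
      rw [← sq_abs]; gcongr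
    rw [e, norm_smul, mul_pow, Real.norm_eq_abs, sq_abs]
    -- The unequal splittings, here 3/2 and below 4/3, keep the leading coefficient at
    -- (3/2)·3d·(4/3)·2L = 12dL, which the step size can absorb.
    have h1 : (inner ℝ a u + r) ^ 2 ≤ 3 / 2 * (inner ℝ a u) ^ 2 + 3 * (μ * L / 2 * ‖u‖ ^ 2) ^ 2 := by
      nlinarith [sq_nonneg (inner ℝ a u - 2 * r)]
    calc (inner ℝ a u + r) ^ 2 * ‖u‖ ^ 2 ≤
        (3 / 2 * (inner ℝ a u) ^ 2 + 3 * (μ * L / 2 * ‖u‖ ^ 2) ^ 2) * ‖u‖ ^ 2 := by gcongr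
      _ = _ := by ring
  have hV : ∫ u, ‖gaussEst h μ q u - gaussEst h μ p u‖ ^ 2 ∂(stdGaussian (Vec d)) ≤
      3 / 2 * (3 * d * ‖a‖ ^ 2) + 3 * (μ * L / 2) ^ 2 * (15 * d ^ 3) := by
    refine (integral_mono_of_nonneg (Filter.Eventually.of_forall fun u => by positivity)
      ((han.const_mul _).add (hn6.const_mul _)) (Filter.Eventually.of_forall hpt)).trans ?_
    simp only [Pi.add_apply]
    rw [integral_add (han.const_mul _) (hn6.const_mul _), integral_const_mul, integral_const_mul]
    gcongr
    · exact integral_inner_sq_mul_norm_sq_le a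
    · exact integral_norm_pow_six_le
  have hbreg := hh.integrable_bregman hL.le μ q p
  have haa : ‖a‖ ^ 2 ≤ 8 / 3 * L *
      (smoothed h μ p - smoothed h μ q - inner ℝ (smoothGrad h μ q) (p - q))
      + 16 * L ^ 2 * μ ^ 2 * d := by
    -- Both gradients are moved to translates by the same μu, so that integrating over u produces
    -- the Bregman gap of the smoothing rather than that of h.
    have hpt2 : ∀ u, ‖a‖ ^ 2 ≤ 8 / 3 * L *
        (h (p + μ • u) - h (q + μ • u) - inner ℝ (gradient h (q + μ • u)) (p - q))
        + 16 * L ^ 2 * μ ^ 2 * ‖u‖ ^ 2 := by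
      intro u
      have c1 := norm_sq_gradient_sub_le hh.convex hh.differentiable hL hh.smooth
        (q + μ • u) (p + μ • u)
      rw [add_sub_add_right_eq_sub] at c1
      have c2 := hh.smooth q (q + μ • u)
      have c3 := hh.smooth (p + μ • u) p
      have hm : ‖μ • u‖ = μ * ‖u‖ := by rw [norm_smul, Real.norm_of_nonneg hμ.le]
      rw [sub_add_cancel_left, norm_neg, hm] at c2
      rw [add_sub_cancel_left, hm] at c3
      have c4 : ‖a‖ ≤ ‖gradient h (q + μ • u) - gradient h (p + μ • u)‖ + 2 * (L * (μ * ‖u‖)) := by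
        have e : a = (gradient h (q + μ • u) - gradient h (p + μ • u)) +
            ((gradient h q - gradient h (q + μ • u)) + (gradient h (p + μ • u) - gradient h p)) := by
          rw [ha]; abel
        rw [e]
        refine (norm_add_le _ _).trans ?_
        have := norm_add_le (gradient h q - gradient h (q + μ • u))
          (gradient h (p + μ • u) - gradient h p)
        linarith
      set A := ‖gradient h (q + μ • u) - gradient h (p + μ • u)‖
      set B := L * (μ * ‖u‖) with hB
      have c5 : ‖a‖ ^ 2 ≤ (A + 2 * B) ^ 2 := by gcongr
      have c6 : (A + 2 * B) ^ 2 ≤ 4 / 3 * A ^ 2 + 16 * B ^ 2 := by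
        nlinarith [sq_nonneg (A - 6 * B)]
      have c7 : B ^ 2 = L ^ 2 * μ ^ 2 * ‖u‖ ^ 2 := by rw [hB]; ring
      nlinarith
    have := integral_mono (integrable_const (‖a‖ ^ 2))
      ((hbreg.const_mul (8 / 3 * L)).add (hn2.const_mul (16 * L ^ 2 * μ ^ 2))) hpt2
    simp only [Pi.add_apply] at this
    rw [integral_add (hbreg.const_mul _) (hn2.const_mul _), integral_const_mul, integral_const_mul,
      integral_norm_sq_stdGaussian, ← hh.smoothed_bregman hL.le] at this
    simpa using this
  have hd0 : (0 : ℝ) ≤ d := Nat.cast_nonneg d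
  have := mul_le_mul_of_nonneg_left haa (by positivity : 0 ≤ 9 / 2 * (d : ℝ))
  nlinarith

end IsConvexSmooth

/-! ### The finite-sum objective and the bias of the pivot gradient. -/

namespace ConvexSmooth

variable {f : Fin n → Vec d → ℝ} {L μ ν : ℝ}

theorem component (hf : ConvexSmooth f L) (i : Fin n) : IsConvexSmooth (f i) L :=
  ⟨hf.convex i, hf.differentiable i, hf.smooth i⟩

theorem gradient_average (hf : ConvexSmooth f L) (x : Vec d) :
    gradient (average f) x = (1 / (n : ℝ)) • ∑ i, gradient (f i) x := by
  refine HasGradientAt.gradient ?_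
  rw [hasGradientAt_iff_hasFDerivAt]
  have h1 := (HasFDerivAt.fun_sum (u := Finset.univ) fun i _ =>
    ((hf.differentiable i) x).hasGradientAt.hasFDerivAt).const_mul (1 / (n : ℝ))
  refine h1.congr_fderiv ?_
  simp

theorem isConvexSmooth_average (hn : 0 < n) (hf : ConvexSmooth f L) :
    IsConvexSmooth (average f) L := by
  have hn' : (0 : ℝ) < n := Nat.cast_pos.2 hn
  refine ⟨?_, ?_, fun x y => ?_⟩
  · refine ⟨convex_univ, fun x _ y _ a b ha hb hab => ?_⟩
    simp only [average, smul_eq_mul]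
    have : ∑ i, f i (a • x + b • y) ≤ ∑ i, (a * f i x + b * f i y) :=
      Finset.sum_le_sum fun i _ => (hf.convex i).2 (Set.mem_univ _) (Set.mem_univ _) ha hb hab
    rw [Finset.sum_add_distrib, ← Finset.mul_sum, ← Finset.mul_sum] at this
    have h2 := mul_le_mul_of_nonneg_left this (by positivity : 0 ≤ 1 / (n : ℝ))
    linarith
  · have : Differentiable ℝ fun x => ∑ i, f i x :=
      Differentiable.fun_sum fun i _ => hf.differentiable i
    exact this.const_mul _
  · rw [hf.gradient_average, hf.gradient_average, ← smul_sub, ← Finset.sum_sub_distrib, norm_smul,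
      Real.norm_of_nonneg (by positivity)]
    calc 1 / (n : ℝ) * ‖∑ i, (gradient (f i) x - gradient (f i) y)‖
        ≤ 1 / (n : ℝ) * ∑ _i : Fin n, L * ‖x - y‖ := by
          gcongr
          exact norm_sum_le_of_le _ fun i _ => hf.smooth i x y
      _ = L * ‖x - y‖ := by simp; field_simp

theorem smoothed_average (hf : ConvexSmooth f L) (hL : 0 ≤ L) (x : Vec d) :
    smoothed (average f) μ x = 1 / (n : ℝ) * ∑ i, smoothed (f i) μ x := by
  simp only [smoothed, average]
  rw [integral_const_mul, integral_finsetSum _ fun i _ => (hf.component i).integrable_comp hL μ x]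

theorem smoothGrad_average (hf : ConvexSmooth f L) (hL : 0 ≤ L) (x : Vec d) :
    smoothGrad (average f) μ x = (1 / (n : ℝ)) • ∑ i, smoothGrad (f i) μ x := by
  simp only [smoothGrad, hf.gradient_average]
  rw [integral_smul, integral_finsetSum _ fun i _ =>
    (hf.component i).integrable_gradient_comp hL μ x]

/-- The triangle inequality through ∇f(x), with (A + B)² ≤ 2A² + 2B²; the smoothing part fits into
`errE` because 2d ≤ (d+3)³/2. -/
theorem norm_coordEst_sub_smoothGrad_le (hn : 0 < n) (hf : ConvexSmooth f L) (hL : 0 ≤ L)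
    (hν : 0 < ν) (x : Vec d) :
    ‖coordEst (average f) ν x - smoothGrad (average f) μ x‖ ≤ Real.sqrt (errE d L μ ν) := by
  refine Real.le_sqrt_of_sq_le ?_
  have hh := hf.isConvexSmooth_average hn
  have h1 := hh.norm_sq_coordEst_sub_gradient_le hν x
  have h2 := hh.norm_sq_smoothGrad_sub_gradient_le (μ := μ) hL x
  have h3 := norm_sub_le (coordEst (average f) ν x - gradient (average f) x)
    (smoothGrad (average f) μ x - gradient (average f) x)
  rw [sub_sub_sub_cancel_right] at h3
  set A := ‖coordEst (average f) ν x - gradient (average f) x‖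
  set B := ‖smoothGrad (average f) μ x - gradient (average f) x‖
  have h4 : ‖coordEst (average f) ν x - smoothGrad (average f) μ x‖ ^ 2 ≤ (A + B) ^ 2 := by gcongr
  have h5 : (A + B) ^ 2 ≤ 2 * A ^ 2 + 2 * B ^ 2 := by nlinarith [sq_nonneg (A - B)]
  have hd0 : (0 : ℝ) ≤ d := Nat.cast_nonneg d
  have h6 : (2 : ℝ) * d ≤ ((d : ℝ) + 3) ^ 3 / 2 := by nlinarith [pow_nonneg hd0 2, pow_nonneg hd0 3]
  have h7 := mul_le_mul_of_nonneg_left h6 (by positivity : 0 ≤ μ ^ 2 * L ^ 2)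
  rw [errE]
  nlinarith

end ConvexSmooth

/-! ### Integration over one sample, and moments of the noise. -/

/-- The joint law of one sample `(u, i)`. -/
def sampleLaw (d n : ℕ) : Measure (Vec d × Fin n) :=
  (stdGaussian (Vec d)).prod (uniformOn Set.univ)

theorem isProbabilityMeasure_sampleLaw (hn : 0 < n) : IsProbabilityMeasure (sampleLaw d n) := by
  have : Nonempty (Fin n) := ⟨⟨0, hn⟩⟩
  unfold sampleLaw
  infer_instance

/-- The index set is countable, so joint measurability needs continuity only for each fixed index.
-/
theorem measurable_of_continuous_slice {X G : Type*} [TopologicalSpace X]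
    [MeasurableSpace X] [BorelSpace X] [NormedAddCommGroup G] [MeasurableSpace G] [BorelSpace G]
    {φ : X × Fin n → G}
    (hφ : ∀ i, Continuous fun x => φ (x, i)) : Measurable φ :=
  measurable_from_prod_countable_left fun i => (hφ i).measurable

section SampleIntegral

variable {G : Type*} [NormedAddCommGroup G]

theorem integrable_sampleLaw {φ : Vec d × Fin n → G}
    (hφ : AEStronglyMeasurable φ (sampleLaw d n))
    (hI : ∀ i, Integrable (fun u => φ (u, i)) (stdGaussian (Vec d))) :
    Integrable φ (sampleLaw d n) := by
  unfold sampleLaw at *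
  exact (integrable_prod_iff' hφ).2 ⟨Filter.Eventually.of_forall hI, Integrable.of_finite⟩

theorem integral_sampleLaw [NormedSpace ℝ G] (hn : 0 < n) [CompleteSpace G] {φ : Vec d × Fin n → G}
    (hφ : AEStronglyMeasurable φ (sampleLaw d n))
    (hI : ∀ i, Integrable (fun u => φ (u, i)) (stdGaussian (Vec d))) :
    ∫ ξ, φ ξ ∂(sampleLaw d n) = (1 / (n : ℝ)) • ∑ i, ∫ u, φ (u, i) ∂(stdGaussian (Vec d)) := by
  have : Nonempty (Fin n) := ⟨⟨0, hn⟩⟩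
  have h1 := integrable_sampleLaw hφ hI
  unfold sampleLaw at *
  rw [integral_prod_symm _ h1, integral_fintype .of_finite, Finset.smul_sum]
  refine Finset.sum_congr rfl fun i _ => ?_
  congr 1
  simp [Measure.real, uniformOn_univ]

end SampleIntegral

/-- The difference of the two-point estimators at `q` and at `p` with a common sample. -/
def noise (f : Fin n → Vec d → ℝ) (μ : ℝ) (q p : Vec d) (ξ : Vec d × Fin n) : Vec d :=
  gaussEst (f ξ.2) μ q ξ.1 - gaussEst (f ξ.2) μ p ξ.1

namespace ConvexSmooth

variable {f : Fin n → Vec d → ℝ} {L μ ν : ℝ}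

theorem measurable_noise (hf : ConvexSmooth f L) :
    Measurable fun z : ((Vec d × Vec d) × Vec d) × Fin n =>
      noise f μ z.1.1.1 z.1.1.2 (z.1.2, z.2) := by
  refine measurable_of_continuous_slice fun i => ?_
  have h1 := (hf.component i).continuous_gaussEst (μ := μ)
  simp only [noise]
  fun_prop

theorem measurable_noise_right (hf : ConvexSmooth f L) (q p : Vec d) :
    Measurable (noise f μ q p) := by
  refine measurable_of_continuous_slice fun i => ?_
  have h1 := (hf.component i).continuous_gaussEst (μ := μ)
  simp only [noise]
  fun_prop

theorem exists_norm_noise_le (hf : ConvexSmooth f L) (hL : 0 ≤ L) (hμ : 0 < μ) :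
    ∃ K, 0 ≤ K ∧ ∀ q p ξ, ‖noise f μ q p ξ‖ ≤ K * (2 + ‖q‖ + ‖p‖) * (1 + ‖ξ.1‖) ^ 3 := by
  refine ⟨∑ i, (‖gradient (f i) 0‖ + L + L * μ), by positivity, fun q p ξ => ?_⟩
  have hi : ‖gradient (f ξ.2) 0‖ + L + L * μ ≤ ∑ i, (‖gradient (f i) 0‖ + L + L * μ) :=
    Finset.single_le_sum (f := fun i => ‖gradient (f i) 0‖ + L + L * μ)
      (fun i _ => by positivity) (Finset.mem_univ ξ.2)
  refine (norm_sub_le _ _).trans ((add_le_add ((hf.component ξ.2).norm_gaussEst_le hL hμ q ξ.1)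
    ((hf.component ξ.2).norm_gaussEst_le hL hμ p ξ.1)).trans ?_)
  calc _ = (‖gradient (f ξ.2) 0‖ + L + L * μ) * (2 + ‖q‖ + ‖p‖) * (1 + ‖ξ.1‖) ^ 3 := by ring
    _ ≤ _ := by gcongr

theorem integrable_noise (hf : ConvexSmooth f L) (hL : 0 ≤ L) (hμ : 0 < μ)
    (q p : Vec d) : Integrable (noise f μ q p) (sampleLaw d n) :=
  integrable_sampleLaw (hf.measurable_noise_right q p).aestronglyMeasurable fun i =>
    ((hf.component i).integrable_gaussEst hL hμ q).sub ((hf.component i).integrable_gaussEst hL hμ p)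

theorem integral_noise (hn : 0 < n) (hf : ConvexSmooth f L) (hL : 0 ≤ L) (hμ : 0 < μ)
    (q p : Vec d) :
    ∫ ξ, noise f μ q p ξ ∂(sampleLaw d n) =
      smoothGrad (average f) μ q - smoothGrad (average f) μ p := by
  rw [integral_sampleLaw hn (hf.measurable_noise_right q p).aestronglyMeasurable fun i =>
    ((hf.component i).integrable_gaussEst hL hμ q).sub ((hf.component i).integrable_gaussEst hL hμ p),
    hf.smoothGrad_average hL, hf.smoothGrad_average hL, ← smul_sub, ← Finset.sum_sub_distrib]
  congr 1
  refine Finset.sum_congr rfl fun i _ => ?_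
  simp only [noise]
  rw [integral_sub ((hf.component i).integrable_gaussEst hL hμ q)
    ((hf.component i).integrable_gaussEst hL hμ p), (hf.component i).integral_gaussEst hL hμ,
    (hf.component i).integral_gaussEst hL hμ]

theorem integrable_norm_sq_noise_slice (hf : ConvexSmooth f L) (hL : 0 ≤ L) (hμ : 0 < μ)
    (q p : Vec d) (i : Fin n) :
    Integrable (fun u => ‖noise f μ q p (u, i)‖ ^ 2) (stdGaussian (Vec d)) := by
  obtain ⟨K, hK0, hK⟩ := hf.exists_norm_noise_le hL hμ
  refine integrable_of_growth _ (K := (K * (2 + ‖q‖ + ‖p‖)) ^ 2) (m := 6)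
    (((hf.measurable_noise_right q p).comp (by fun_prop : Measurable fun u : Vec d => (u, i))
      ).norm.pow_const 2).aestronglyMeasurable fun u => ?_
  rw [norm_pow, norm_norm]
  calc ‖noise f μ q p (u, i)‖ ^ 2 ≤ (K * (2 + ‖q‖ + ‖p‖) * (1 + ‖u‖) ^ 3) ^ 2 := by
        gcongr; exact hK q p (u, i)
    _ = _ := by ring

theorem integrable_norm_sq_noise (hf : ConvexSmooth f L) (hL : 0 ≤ L) (hμ : 0 < μ)
    (q p : Vec d) : Integrable (fun ξ => ‖noise f μ q p ξ‖ ^ 2) (sampleLaw d n) :=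
  integrable_sampleLaw ((hf.measurable_noise_right q p).norm.pow_const 2).aestronglyMeasurable
    (hf.integrable_norm_sq_noise_slice hL hμ q p)

theorem integral_norm_sq_noise_le (hn : 0 < n) (hf : ConvexSmooth f L) (hL : 0 < L) (hμ : 0 < μ)
    (q p : Vec d) :
    ∫ ξ, ‖noise f μ q p ξ‖ ^ 2 ∂(sampleLaw d n) ≤
      12 * d * L * (smoothed (average f) μ p - smoothed (average f) μ q
        - inner ℝ (smoothGrad (average f) μ q) (p - q))
        + 72 * L ^ 2 * μ ^ 2 * d ^ 2 + 45 / 4 * μ ^ 2 * L ^ 2 * d ^ 3 := by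
  rw [integral_sampleLaw hn
    ((hf.measurable_noise_right q p).norm.pow_const 2).aestronglyMeasurable
    (hf.integrable_norm_sq_noise_slice hL.le hμ q p), hf.smoothed_average hL.le,
    hf.smoothed_average hL.le, hf.smoothGrad_average hL.le, inner_smul_left, sum_inner]
  have hn' : (0 : ℝ) < n := Nat.cast_pos.2 hn
  have h := Finset.sum_le_sum fun i (_ : i ∈ Finset.univ) =>
    (hf.component i).integral_norm_sq_gaussEst_sub_le hL hμ q p
  have h2 := mul_le_mul_of_nonneg_left h (by positivity : 0 ≤ 1 / (n : ℝ))
  refine h2.trans (le_of_eq ?_)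
  simp only [Finset.sum_add_distrib, ← Finset.mul_sum, Finset.sum_sub_distrib, Finset.sum_const,
    Finset.card_univ, Fintype.card_fin, nsmul_eq_mul]
  simp
  field_simp

end ConvexSmooth

/-! ### The Lyapunov inequality for one inner step at a fixed state. -/

/-- The gap of the smoothed objective, tilted by the bias of the gradient estimate at the pivot. -/
def potential (f : Fin n → Vec d → ℝ) (μ ν : ℝ) (xstar pv y : Vec d) : ℝ :=
  smoothed (average f) μ y - smoothed (average f) μ xstar
    + inner ℝ (coordEst (average f) ν pv - smoothGrad (average f) μ pv) (y - xstar)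

/-- One inner iteration with `τ = 0` and `p = 1/2`, from the state `((x, x̄), pivot)`. -/
def innerStep (f : Fin n → Vec d → ℝ) (μ ν γ α : ℝ) (z : (Vec d × Vec d) × Vec d)
    (ξ : Vec d × Fin n) : Vec d × Vec d :=
  let q := (1 / 2 - α) • z.1.2 + α • z.1.1 + (1 / 2 : ℝ) • z.2
  let x := z.1.1 - γ • (noise f μ q z.2 ξ + coordEst (average f) ν z.2)
  (x, (1 / 2 - α) • z.1.2 + α • x + (1 / 2 : ℝ) • z.2)

theorem innerIter_succ (f : Fin n → Vec d → ℝ) (μ ν γ α : ℝ) (x0 pv : Vec d)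
    (ξ : ℕ → Vec d × Fin n) (t : ℕ) :
    innerIter f μ ν γ α (1 / 2) 0 x0 pv ξ (t + 1) =
      innerStep f μ ν γ α (innerIter f μ ν γ α (1 / 2) 0 x0 pv ξ t, pv) (ξ (t + 1)) := by
  simp only [innerIter, innerStep, proxStep, queryPoint, noise, mul_zero, zero_mul, add_zero,
    inv_one, one_smul, zero_smul, one_mul]
  rw [show 1 - α - 1 / 2 = 1 / 2 - α by ring]

/-- The centred linear term integrates to zero, and the variance is at most the second moment. -/
theorem integral_quadratic_le {X : Type*} [MeasurableSpace X] {Q : Measure X}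
    [IsProbabilityMeasure Q] {ψ : X → ℝ} {N : X → Vec d} (hψ : Integrable ψ Q)
    (hN : Integrable N Q) (hN2 : Integrable (fun ξ => ‖N ξ‖ ^ 2) Q) {C κ : ℝ} (hκ : 0 ≤ κ)
    {w : Vec d} (h : ∀ ξ, ψ ξ ≤ C + inner ℝ w (N ξ - ∫ ζ, N ζ ∂Q)
      + κ * ‖N ξ - ∫ ζ, N ζ ∂Q‖ ^ 2) :
    ∫ ξ, ψ ξ ∂Q ≤ C + κ * ∫ ξ, ‖N ξ‖ ^ 2 ∂Q := by
  set m := ∫ ζ, N ζ ∂Q with hm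
  have e : ∀ ξ, ‖N ξ - m‖ ^ 2 = ‖N ξ‖ ^ 2 - 2 * inner ℝ m (N ξ) + ‖m‖ ^ 2 := by
    intro ξ
    rw [norm_sub_sq_real, real_inner_comm]
  have h' : ∀ ξ, ψ ξ ≤ (C - inner ℝ w m + κ * ‖m‖ ^ 2) + inner ℝ (w - (2 * κ) • m) (N ξ)
      + κ * ‖N ξ‖ ^ 2 := by
    intro ξ
    refine (h ξ).trans (le_of_eq ?_)
    rw [e, inner_sub_right, inner_sub_left, inner_smul_left]
    simp only [map_mul, map_ofNat, Real.ringHom_apply]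
    ring
  have i1 : Integrable (fun ξ => inner ℝ (w - (2 * κ) • m) (N ξ)) Q := hN.const_inner _
  have i2 : Integrable (fun ξ => κ * ‖N ξ‖ ^ 2) Q := hN2.const_mul κ
  have i3 : Integrable (fun ξ => (C - inner ℝ w m + κ * ‖m‖ ^ 2)
    + inner ℝ (w - (2 * κ) • m) (N ξ)) Q := (integrable_const _).add i1
  refine (integral_mono hψ (i3.add i2) h').trans ?_
  simp only [Pi.add_apply]
  rw [integral_add i3 i2, integral_add (integrable_const _) i1, integral_const_mul,
    integral_inner hN, ← hm, inner_sub_left, inner_smul_left, real_inner_self_eq_norm_sq]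
  simp only [integral_const, probReal_univ, one_smul, map_mul, map_ofNat, Real.ringHom_apply]
  have : 0 ≤ κ * ‖m‖ ^ 2 := by positivity
  linarith

/-- The factor in front is the coefficient of ‖δ‖² in `potential_step_le`. The resulting 1/2 on D is
exactly the pivot weight p_s, so D cancels there. -/
theorem variance_coefficient_le {L γ α : ℝ} (hL : 0 < L) (hγα : 12 * ((d : ℝ) + 4) * L * (γ * α) = 1)
    (D μ : ℝ) (hD : 0 ≤ D) :
    (γ * α / 2 * (1 + L * (γ * α))) *
      (12 * d * L * D + 72 * L ^ 2 * μ ^ 2 * d ^ 2 + 45 / 4 * μ ^ 2 * L ^ 2 * d ^ 3) ≤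
      1 / 2 * D + err1 d L μ := by
  have hd0 : (0 : ℝ) ≤ d := Nat.cast_nonneg d
  have e : γ * α = 1 / (12 * ((d : ℝ) + 4) * L) := by
    rw [eq_div_iff (by positivity)]; linarith
  have hκ : γ * α / 2 * (1 + L * (γ * α)) =
      (12 * ((d : ℝ) + 4) + 1) / (288 * ((d : ℝ) + 4) ^ 2 * L) := by
    rw [e]; field_simp; ring
  rw [hκ, err1, div_mul_eq_mul_div, div_le_iff₀ (by positivity)]
  have p2 : (0 : ℝ) ≤ (d : ℝ) ^ 2 := by positivity
  have p3 : (0 : ℝ) ≤ (d : ℝ) ^ 3 := by positivity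
  have p4 : (0 : ℝ) ≤ (d : ℝ) ^ 4 := by positivity
  have a1 : (12 * ((d : ℝ) + 4) + 1) * (12 * d) ≤ 144 * ((d : ℝ) + 4) ^ 2 := by nlinarith
  have a2 : (12 * ((d : ℝ) + 4) + 1) * (72 * (d : ℝ) ^ 2 + 45 / 4 * (d : ℝ) ^ 3) ≤
      288 * ((d : ℝ) + 4) ^ 4 := by nlinarith
  have b1 := mul_le_mul_of_nonneg_right a1 (by positivity : 0 ≤ L * D)
  have b2 := mul_le_mul_of_nonneg_right a2 (by positivity : 0 ≤ L ^ 2 * μ ^ 2)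
  nlinarith

namespace ConvexSmooth

variable {f : Fin n → Vec d → ℝ} {L μ ν : ℝ}

/-- Pointwise expansion of the potential along an inner step with gradient estimate
`smoothGrad q + b + δ`. -/
theorem potential_step_le {h : Vec d → ℝ} (hh : IsConvexSmooth h L) (hL : 0 < L) {γ α : ℝ}
    (hγ : 0 < γ) (hα : 0 < α) (hα2 : α ≤ 1 / 2) (hLγ : L * (γ * α) ≤ 1)
    (x xb pv xstar b δ q x' xb' : Vec d)
    (hq : q = (1 / 2 - α) • xb + α • x + (1 / 2 : ℝ) • pv)
    (hx' : x' = x - γ • (smoothGrad h μ q + b + δ))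
    (hxb' : xb' = (1 / 2 - α) • xb + α • x' + (1 / 2 : ℝ) • pv) :
    (smoothed h μ xb' - smoothed h μ xstar + inner ℝ b (xb' - xstar))
        + α / (2 * γ) * ‖x' - xstar‖ ^ 2 ≤
      ((1 / 2 - α) * (smoothed h μ xb - smoothed h μ xstar + inner ℝ b (xb - xstar))
        + 1 / 2 * (smoothed h μ pv - smoothed h μ xstar + inner ℝ b (pv - xstar))
        + α / (2 * γ) * ‖x - xstar‖ ^ 2
        - 1 / 2 * (smoothed h μ pv - smoothed h μ q - inner ℝ (smoothGrad h μ q) (pv - q)))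
      + inner ℝ ((L * (γ * α) * (γ * α)) • (smoothGrad h μ q + b) - α • (x - xstar)) δ
      + (γ * α / 2 * (1 + L * (γ * α))) * ‖δ‖ ^ 2 := by
  set g := smoothGrad h μ q with hg
  set m := g + b with hm
  have e1 : xb' - q = (-(γ * α)) • (m + δ) := by rw [hxb', hx', hq]; module
  have e2 : x' - xstar = (x - xstar) - γ • (m + δ) := by rw [hx']; abel
  have e3 : xb' - xstar = (1 / 2 - α) • (xb - xstar) + α • (x - xstar)
      + (1 / 2 : ℝ) • (pv - xstar) - (γ * α) • (m + δ) := by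
    rw [hxb', hx']; module
  -- This rewrites α(x − x*) through displacements from q, where the first-order inequalities are
  -- based.
  have e4 : α • (x - xstar) = -((1 / 2 - α) • (xb - q) + (1 / 2 : ℝ) • (pv - q)
      + α • (xstar - q)) := by
    rw [hq]; module
  -- No convexity inequality is spent on the pivot: its Bregman gap stays in the bound, to absorb
  -- the noise.
  have s1 := hh.smoothed_le (μ := μ) hL.le q xb'
  have s2 := hh.smoothed_ge (μ := μ) hL.le q xb
  have s3 := hh.smoothed_ge (μ := μ) hL.le q xstar
  rw [← hg] at s1 s2 s3
  have n1 : ‖xb' - q‖ ^ 2 = (γ * α) ^ 2 * ‖m + δ‖ ^ 2 := by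
    rw [e1, norm_smul, mul_pow, Real.norm_eq_abs, sq_abs, neg_sq]
  have n2 : α / (2 * γ) * ‖x' - xstar‖ ^ 2 = α / (2 * γ) * ‖x - xstar‖ ^ 2
      - α * inner ℝ (x - xstar) (m + δ) + γ * α / 2 * ‖m + δ‖ ^ 2 := by
    rw [e2, norm_sub_sq_real, inner_smul_right, norm_smul, mul_pow, Real.norm_eq_abs, sq_abs]
    field_simp
  have n3 : ‖m + δ‖ ^ 2 = ‖m‖ ^ 2 + 2 * inner ℝ m δ + ‖δ‖ ^ 2 := norm_add_sq_real m δ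
  have n4 : inner ℝ g (xb' - q) = -(γ * α) * inner ℝ g (m + δ) := by rw [e1, inner_smul_right]
  have n5 : inner ℝ b (xb' - xstar) = (1 / 2 - α) * inner ℝ b (xb - xstar)
      + α * inner ℝ b (x - xstar) + 1 / 2 * inner ℝ b (pv - xstar)
      - γ * α * inner ℝ b (m + δ) := by
    rw [e3, inner_sub_right, inner_add_right, inner_add_right, inner_smul_right, inner_smul_right,
      inner_smul_right, inner_smul_right]
  have n6 : inner ℝ g (m + δ) + inner ℝ b (m + δ) = ‖m‖ ^ 2 + inner ℝ m δ := by
    rw [← inner_add_left, ← hm, inner_add_right, real_inner_self_eq_norm_sq]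
  have n7 : inner ℝ (x - xstar) (m + δ) =
      inner ℝ g (x - xstar) + inner ℝ b (x - xstar) + inner ℝ (x - xstar) δ := by
    rw [inner_add_right, hm, inner_add_right, real_inner_comm g, real_inner_comm b]
  have n8 : α * inner ℝ g (x - xstar) = -((1 / 2 - α) * inner ℝ g (xb - q)
      + 1 / 2 * inner ℝ g (pv - q) + α * inner ℝ g (xstar - q)) := by
    rw [← inner_smul_right, e4, inner_neg_right, inner_add_right, inner_add_right,
      inner_smul_right, inner_smul_right, inner_smul_right]
  have n9 : inner ℝ ((L * (γ * α) * (γ * α)) • m - α • (x - xstar)) δ =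
      L * (γ * α) * (γ * α) * inner ℝ m δ - α * inner ℝ (x - xstar) δ := by
    rw [inner_sub_left, real_inner_smul_left, real_inner_smul_left]
  -- The descent term −γα‖m‖² outweighs the quadratic costs γα/2 and L(γα)²/2, since Lγα ≤ 1.
  have hneg : γ * α / 2 * (L * (γ * α) - 1) * ‖m‖ ^ 2 ≤ 0 :=
    mul_nonpos_of_nonpos_of_nonneg
      (mul_nonpos_of_nonneg_of_nonpos (by positivity) (by linarith)) (by positivity)
  have s2' := mul_le_mul_of_nonneg_left s2 (by linarith : 0 ≤ 1 / 2 - α)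
  have s3' := mul_le_mul_of_nonneg_left s3 hα.le
  rw [n9, n2, n5, n7]
  rw [n1, n4] at s1
  have n6' : inner ℝ b (m + δ) = ‖m‖ ^ 2 + inner ℝ m δ - inner ℝ g (m + δ) := by linarith
  rw [n6', n3]
  rw [n3] at s1
  linarith

/-- Integrability is a hypothesis because Fubini later supplies it for almost every state only. -/
theorem integral_potential_step_le (hn : 0 < n) (hf : ConvexSmooth f L) (hL : 0 < L) (hμ : 0 < μ)
    {γ α : ℝ} (hγ : 0 < γ) (hα : 0 < α) (hα2 : α ≤ 1 / 2)
    (hγα : 12 * ((d : ℝ) + 4) * L * (γ * α) = 1) (xstar : Vec d) (z : (Vec d × Vec d) × Vec d)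
    (hint : Integrable (fun ξ => potential f μ ν xstar z.2 (innerStep f μ ν γ α z ξ).2
        + α / (2 * γ) * ‖(innerStep f μ ν γ α z ξ).1 - xstar‖ ^ 2) (sampleLaw d n)) :
    ∫ ξ, (potential f μ ν xstar z.2 (innerStep f μ ν γ α z ξ).2
        + α / (2 * γ) * ‖(innerStep f μ ν γ α z ξ).1 - xstar‖ ^ 2) ∂(sampleLaw d n) ≤
      (1 / 2 - α) * potential f μ ν xstar z.2 z.1.2 + 1 / 2 * potential f μ ν xstar z.2 z.2
        + α / (2 * γ) * ‖z.1.1 - xstar‖ ^ 2 + err1 d L μ := by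
  have := isProbabilityMeasure_sampleLaw (d := d) hn
  have hh := hf.isConvexSmooth_average hn
  obtain ⟨⟨x, xb⟩, pv⟩ := z
  set q := (1 / 2 - α) • xb + α • x + (1 / 2 : ℝ) • pv with hq
  set b := coordEst (average f) ν pv - smoothGrad (average f) μ pv with hb
  have hd0 : (0 : ℝ) ≤ d := Nat.cast_nonneg d
  have hLγ0 : 0 ≤ L * (γ * α) := by positivity
  have hLγ : L * (γ * α) ≤ 1 := by nlinarith
  have hpt := fun ξ => potential_step_le (μ := μ) hh hL hγ hα hα2 hLγ x xb pv xstar b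
    (noise f μ q pv ξ - ∫ ζ, noise f μ q pv ζ ∂(sampleLaw d n)) q
    (innerStep f μ ν γ α ((x, xb), pv) ξ).1 (innerStep f μ ν γ α ((x, xb), pv) ξ).2 hq
    (by
      rw [hf.integral_noise hn hL.le hμ]
      simp only [innerStep, hb, ← hq]
      congr 2
      abel) rfl
  have hmain := integral_quadratic_le (C := _) hint (hf.integrable_noise hL.le hμ q pv)
    (hf.integrable_norm_sq_noise hL.le hμ q pv)
    (by positivity : 0 ≤ γ * α / 2 * (1 + L * (γ * α))) hpt
  refine hmain.trans ?_
  have hV := mul_le_mul_of_nonneg_left (hf.integral_norm_sq_noise_le hn hL hμ q pv)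
    (by positivity : 0 ≤ γ * α / 2 * (1 + L * (γ * α)))
  have hD := hh.smoothed_ge (μ := μ) hL.le q pv
  have hvar := variance_coefficient_le hL hγα (smoothed (average f) μ pv
    - smoothed (average f) μ q - inner ℝ (smoothGrad (average f) μ q) (pv - q)) μ (by linarith)
  simp only [potential, ← hb]
  linarith

end ConvexSmooth

/-! ### Measurability of the step and of the potential. -/

namespace ConvexSmooth

variable {f : Fin n → Vec d → ℝ} {L μ ν : ℝ}

theorem continuous_coordEst (hn : 0 < n) (hf : ConvexSmooth f L) :
    Continuous (coordEst (average f) ν) := by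
  have := (hf.isConvexSmooth_average hn).continuous
  unfold coordEst
  fun_prop

theorem measurable_innerStep (hn : 0 < n) (hf : ConvexSmooth f L) (γ α : ℝ) :
    Measurable fun w : ((Vec d × Vec d) × Vec d) × (Vec d × Fin n) =>
      innerStep f μ ν γ α w.1 w.2 := by
  have hslice : Measurable fun w : (((Vec d × Vec d) × Vec d) × Vec d) × Fin n =>
      innerStep f μ ν γ α w.1.1 (w.1.2, w.2) := by
    refine measurable_of_continuous_slice fun i => ?_
    have h1 := (hf.component i).continuous_gaussEst (μ := μ)
    have h2 := hf.continuous_coordEst (ν := ν) hn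
    simp only [innerStep, noise]
    fun_prop
  have h := hslice.comp (by fun_prop : Measurable
    fun w : ((Vec d × Vec d) × Vec d) × (Vec d × Fin n) => ((w.1, w.2.1), w.2.2))
  simpa only [Function.comp_def] using h

theorem measurable_potential (hn : 0 < n) (hf : ConvexSmooth f L) (hL : 0 ≤ L) (xstar : Vec d) :
    Measurable fun w : Vec d × Vec d => potential f μ ν xstar w.1 w.2 := by
  have hh := hf.isConvexSmooth_average hn
  have h1 := hh.continuous_smoothed (μ := μ) hL
  have h2 := hh.continuous_smoothGrad (μ := μ) hL
  have h3 := hf.continuous_coordEst (ν := ν) hn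
  unfold potential
  refine Continuous.measurable ?_
  fun_prop

end ConvexSmooth

/-! ### Random states: square integrability and the expected one-step inequality. -/

section Random

variable {f : Fin n → Vec d → ℝ} {L μ ν : ℝ}
variable {Ω : Type*} [MeasurableSpace Ω] {P : Measure Ω} [IsProbabilityMeasure P]

theorem integrable_smoothed_comp (hn : 0 < n) (hf : ConvexSmooth f L) (hL : 0 ≤ L)
    {y : Ω → Vec d} (hy : MemLp y 2 P) :
    Integrable (fun ω => smoothed (average f) μ (y ω)) P := by
  have hh := hf.isConvexSmooth_average hn
  have h1 : MemLp (fun ω => 1 + ‖y ω‖) 2 P := (memLp_const (1 : ℝ)).add hy.norm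
  refine (h1.integrable_sq.const_mul
    (|smoothed (average f) μ 0| + ‖smoothGrad (average f) μ 0‖ + L)).mono'
    ((hh.continuous_smoothed (μ := μ) hL).comp_aestronglyMeasurable hy.1)
    (Filter.Eventually.of_forall fun ω => hh.abs_smoothed_le_growth hL (y ω))

theorem integrable_bias (hn : 0 < n) (hf : ConvexSmooth f L) (hL : 0 ≤ L) (hν : 0 < ν)
    (xstar : Vec d) {y pv : Ω → Vec d} (hy : MemLp y 2 P) (hpv : MemLp pv 2 P) :
    Integrable (fun ω => inner ℝ (coordEst (average f) ν (pv ω)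
      - smoothGrad (average f) μ (pv ω)) (y ω - xstar)) P := by
  have hh := hf.isConvexSmooth_average hn
  have h1 : Integrable (fun ω => ‖y ω - xstar‖) P :=
    ((hy.sub (memLp_const xstar)).integrable (by norm_num)).norm
  refine (h1.const_mul (Real.sqrt (errE d L μ ν))).mono' ?_
    (Filter.Eventually.of_forall fun ω => ?_)
  · have h2 := (hf.continuous_coordEst (ν := ν) hn).comp_aestronglyMeasurable hpv.1
    have h3 := (hh.continuous_smoothGrad (μ := μ) hL).comp_aestronglyMeasurable hpv.1
    exact (h2.sub h3).inner (hy.1.sub aestronglyMeasurable_const)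
  · refine (norm_inner_le_norm _ _).trans ?_
    gcongr
    exact hf.norm_coordEst_sub_smoothGrad_le hn hL hν _

theorem integrable_potential (hn : 0 < n) (hf : ConvexSmooth f L) (hL : 0 ≤ L) (hν : 0 < ν)
    (xstar : Vec d) {y pv : Ω → Vec d} (hy : MemLp y 2 P) (hpv : MemLp pv 2 P) :
    Integrable (fun ω => potential f μ ν xstar (pv ω) (y ω)) P :=
  ((integrable_smoothed_comp hn hf hL hy).sub (integrable_const _)).add
    (integrable_bias hn hf hL hν xstar hy hpv)

/-- The cost of removing the tilt, by Cauchy–Schwarz and the uniform bound √E on the bias. -/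
theorem integral_potential_sub_abs_le (hn : 0 < n) (hf : ConvexSmooth f L) (hL : 0 ≤ L) (hν : 0 < ν)
    (xstar : Vec d) {y pv : Ω → Vec d} (hy : MemLp y 2 P) (hpv : MemLp pv 2 P) {Z : ℝ}
    (hZ : ∫ ω, ‖y ω - xstar‖ ∂P ≤ Z) :
    |∫ ω, potential f μ ν xstar (pv ω) (y ω) ∂P - ∫ ω, (smoothed (average f) μ (y ω)
      - smoothed (average f) μ xstar) ∂P| ≤ err2 d L μ ν Z := by
  have h1 : Integrable (fun ω => ‖y ω - xstar‖) P :=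
    ((hy.sub (memLp_const xstar)).integrable (by norm_num)).norm
  have hI : Integrable (fun ω => smoothed (average f) μ (y ω)
      - smoothed (average f) μ xstar) P :=
    (integrable_smoothed_comp hn hf hL hy).sub (integrable_const _)
  simp only [potential]
  rw [integral_add hI (integrable_bias hn hf hL hν xstar hy hpv), add_sub_cancel_left, err2,
    ← Real.norm_eq_abs]
  calc _ ≤ ∫ ω, Real.sqrt (errE d L μ ν) * ‖y ω - xstar‖ ∂P := by
        refine norm_integral_le_of_norm_le (h1.const_mul _) (Filter.Eventually.of_forall fun ω => ?_)
        refine (norm_inner_le_norm _ _).trans ?_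
        gcongr
        exact hf.norm_coordEst_sub_smoothGrad_le hn hL hν _
    _ = Real.sqrt (errE d L μ ν) * ∫ ω, ‖y ω - xstar‖ ∂P := integral_const_mul _ _
    _ ≤ Z * Real.sqrt (errE d L μ ν) := by rw [mul_comm]; gcongr

variable {z : Ω → (Vec d × Vec d) × Vec d} {ξ : Ω → Vec d × Fin n}

/-- The noise grows linearly in the state and cubically in u; independence makes the product of the
two squares integrable. -/
theorem memLp_noise (hf : ConvexSmooth f L) (hL : 0 ≤ L) (hμ : 0 < μ)
    (hξ : Measurable ξ) (hlaw : P.map ξ = sampleLaw d n)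
    {q p : Ω → Vec d} (hqm : Measurable q) (hpm : Measurable p) (hq : MemLp q 2 P)
    (hp : MemLp p 2 P) (hind : IndepFun (fun ω => (q ω, p ω)) ξ P) :
    MemLp (fun ω => noise f μ (q ω) (p ω) (ξ ω)) 2 P := by
  obtain ⟨K, hK0, hK⟩ := hf.exists_norm_noise_le hL hμ
  have hm : Measurable fun ω => noise f μ (q ω) (p ω) (ξ ω) := by
    have h := (hf.measurable_noise (μ := μ)).comp (by fun_prop : Measurable
      fun ω => (((q ω, p ω), (ξ ω).1), (ξ ω).2))
    simpa only [Function.comp_def] using h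
  rw [memLp_two_iff_integrable_sq_norm hm.aestronglyMeasurable]
  have hA : Integrable (fun ω => (2 + ‖q ω‖ + ‖p ω‖) ^ 2) P :=
    (((memLp_const (2 : ℝ)).add hq.norm).add hp.norm).integrable_sq
  have hn : Nonempty (Fin n) := by
    by_contra hne
    rw [not_nonempty_iff] at hne
    have : IsEmpty Ω := ⟨fun ω => hne.elim (ξ ω).2⟩
    exact IsProbabilityMeasure.ne_zero P (Measure.eq_zero_of_isEmpty P)
  have hB : Integrable (fun ω => (1 + ‖(ξ ω).1‖) ^ 6) P := by
    have h1 : Integrable (fun ζ : Vec d × Fin n => (1 + ‖ζ.1‖) ^ 6) (sampleLaw d n) :=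
      integrable_sampleLaw (by fun_prop) fun i => integrable_one_add_norm_pow _ 6
    rw [← hlaw] at h1
    exact h1.comp_measurable hξ
  have hind' := hind.comp (φ := fun w : Vec d × Vec d => (2 + ‖w.1‖ + ‖w.2‖) ^ 2)
    (ψ := fun ζ : Vec d × Fin n => (1 + ‖ζ.1‖) ^ 6) (by fun_prop) (by fun_prop)
  simp only [Function.comp_def] at hind'
  have hAB := hind'.integrable_mul hA hB
  refine (hAB.const_mul (K ^ 2)).mono' (hm.norm.pow_const 2).aestronglyMeasurable
    (Filter.Eventually.of_forall fun ω => ?_)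
  rw [norm_pow, norm_norm]
  calc ‖noise f μ (q ω) (p ω) (ξ ω)‖ ^ 2
      ≤ (K * (2 + ‖q ω‖ + ‖p ω‖) * (1 + ‖(ξ ω).1‖) ^ 3) ^ 2 := by gcongr; exact hK _ _ _
    _ = _ := by simp only [Pi.mul_apply]; ring

theorem memLp_coordEst (hn : 0 < n) (hf : ConvexSmooth f L) (hL : 0 ≤ L) (hν : 0 < ν)
    {p : Ω → Vec d} (hp : MemLp p 2 P) :
    MemLp (fun ω => coordEst (average f) ν (p ω)) 2 P := by
  have hh := hf.isConvexSmooth_average hn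
  -- The smoothing parameter `1` is auxiliary: any fixed value compares the estimator with a
  -- Lipschitz map.
  have h1 : MemLp (fun ω => (Real.sqrt (errE d L 1 ν) + ‖smoothGrad (average f) 1 0‖) +
      L * ‖p ω‖) 2 P :=
    (memLp_const (Real.sqrt (errE d L 1 ν) + ‖smoothGrad (average f) 1 0‖)).add
      (hp.norm.const_mul L)
  refine h1.mono' ((hf.continuous_coordEst hn).comp_aestronglyMeasurable hp.1)
    (Filter.Eventually.of_forall fun ω => ?_)
  have h2 := hf.norm_coordEst_sub_smoothGrad_le (μ := 1) hn hL hν (p ω)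
  have h3 := hh.norm_smoothGrad_sub_le (μ := 1) hL (p ω) 0
  rw [sub_zero] at h3
  have h4 := norm_le_norm_add_norm_sub' (coordEst (average f) ν (p ω))
    (smoothGrad (average f) 1 (p ω))
  have h5 := norm_le_norm_add_norm_sub' (smoothGrad (average f) 1 (p ω))
    (smoothGrad (average f) 1 0)
  linarith

theorem memLp_innerStep (hn : 0 < n) (hf : ConvexSmooth f L) (hL : 0 ≤ L) (hμ : 0 < μ)
    (hν : 0 < ν) (γ α : ℝ) (hz : Measurable z) (hξ : Measurable ξ)
    (hlaw : P.map ξ = sampleLaw d n) (hind : IndepFun z ξ P)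
    (h1 : MemLp (fun ω => (z ω).1.1) 2 P) (h2 : MemLp (fun ω => (z ω).1.2) 2 P)
    (h3 : MemLp (fun ω => (z ω).2) 2 P) :
    MemLp (fun ω => (innerStep f μ ν γ α (z ω) (ξ ω)).1) 2 P ∧
      MemLp (fun ω => (innerStep f μ ν γ α (z ω) (ξ ω)).2) 2 P := by
  have hq : MemLp (fun ω => (1 / 2 - α) • (z ω).1.2 + α • (z ω).1.1 + (1 / 2 : ℝ) • (z ω).2) 2 P :=
    ((h2.const_smul (1 / 2 - α)).add (h1.const_smul α)).add (h3.const_smul (1 / 2 : ℝ))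
  have hind' := hind.comp (φ := fun w : (Vec d × Vec d) × Vec d =>
    ((1 / 2 - α) • w.1.2 + α • w.1.1 + (1 / 2 : ℝ) • w.2, w.2)) (ψ := fun ζ => ζ)
    (by fun_prop) (by fun_prop)
  simp only [Function.comp_def] at hind'
  have hnoise := memLp_noise hf hL hμ hξ hlaw (by fun_prop) (by fun_prop) hq h3 hind'
  have hx : MemLp (fun ω => (innerStep f μ ν γ α (z ω) (ξ ω)).1) 2 P :=
    h1.sub ((hnoise.add (memLp_coordEst hn hf hL hν h3)).const_smul γ)
  exact ⟨hx, ((h2.const_smul (1 / 2 - α)).add (hx.const_smul α)).add (h3.const_smul (1 / 2 : ℝ))⟩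

theorem integrable_norm_sub_sq {y : Ω → Vec d} (hy : MemLp y 2 P) (a : Vec d) :
    Integrable (fun ω => ‖y ω - a‖ ^ 2) P :=
  (hy.sub (memLp_const a)).integrable_norm_pow (by norm_num)

/-- Expected decrease of the Lyapunov function along one inner iteration. -/
theorem expected_potential_step_le (hn : 0 < n) (hf : ConvexSmooth f L) (hL : 0 < L) (hμ : 0 < μ)
    (hν : 0 < ν) {γ α : ℝ} (hγ : 0 < γ) (hα : 0 < α) (hα2 : α ≤ 1 / 2)
    (hγα : 12 * ((d : ℝ) + 4) * L * (γ * α) = 1) (xstar : Vec d)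
    (hz : Measurable z) (hξ : Measurable ξ)
    (hlaw : P.map ξ = sampleLaw d n) (hind : IndepFun z ξ P)
    (h1 : MemLp (fun ω => (z ω).1.1) 2 P) (h2 : MemLp (fun ω => (z ω).1.2) 2 P)
    (h3 : MemLp (fun ω => (z ω).2) 2 P) :
    ∫ ω, potential f μ ν xstar (z ω).2 (innerStep f μ ν γ α (z ω) (ξ ω)).2 ∂P
        + α / (2 * γ) * ∫ ω, ‖(innerStep f μ ν γ α (z ω) (ξ ω)).1 - xstar‖ ^ 2 ∂P ≤
      (1 / 2 - α) * ∫ ω, potential f μ ν xstar (z ω).2 (z ω).1.2 ∂P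
        + 1 / 2 * ∫ ω, potential f μ ν xstar (z ω).2 (z ω).2 ∂P
        + α / (2 * γ) * ∫ ω, ‖(z ω).1.1 - xstar‖ ^ 2 ∂P + err1 d L μ := by
  have := isProbabilityMeasure_sampleLaw (d := d) hn
  obtain ⟨hx, hxb⟩ := memLp_innerStep hn hf hL.le hμ hν γ α hz hξ hlaw hind h1 h2 h3
  have i1 := integrable_potential (μ := μ) hn hf hL.le hν xstar hxb h3
  have i2 := (integrable_norm_sub_sq hx xstar).const_mul (α / (2 * γ))
  have i3 := (integrable_potential (μ := μ) hn hf hL.le hν xstar h2 h3).const_mul (1 / 2 - α)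
  have i4 := (integrable_potential (μ := μ) hn hf hL.le hν xstar h3 h3).const_mul (1 / 2)
  have i5 := (integrable_norm_sub_sq h1 xstar).const_mul (α / (2 * γ))
  let ψ : ((Vec d × Vec d) × Vec d) × (Vec d × Fin n) → ℝ := fun w =>
    potential f μ ν xstar w.1.2 (innerStep f μ ν γ α w.1 w.2).2
        + α / (2 * γ) * ‖(innerStep f μ ν γ α w.1 w.2).1 - xstar‖ ^ 2
  let φ : (Vec d × Vec d) × Vec d → ℝ := fun z =>
    (1 / 2 - α) * potential f μ ν xstar z.2 z.1.2 + 1 / 2 * potential f μ ν xstar z.2 z.2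
        + α / (2 * γ) * ‖z.1.1 - xstar‖ ^ 2 + err1 d L μ
  have hstep := hf.measurable_innerStep (μ := μ) (ν := ν) hn γ α
  have hpot := hf.measurable_potential (μ := μ) (ν := ν) hn hL.le xstar
  have hψm : Measurable ψ :=
    (hpot.comp ((by fun_prop : Measurable
      fun w : ((Vec d × Vec d) × Vec d) × (Vec d × Fin n) => w.1.2).prodMk hstep.snd)).add
      (((hstep.fst.sub_const xstar).norm.pow_const 2).const_mul _)
  have hφm : Measurable φ :=
    ((((hpot.comp (by fun_prop : Measurable
      fun z : (Vec d × Vec d) × Vec d => (z.2, z.1.2))).const_mul _).add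
      ((hpot.comp (by fun_prop : Measurable
      fun z : (Vec d × Vec d) × Vec d => (z.2, z.2))).const_mul _)).add
      (by fun_prop : Measurable fun z : (Vec d × Vec d) × Vec d =>
        α / (2 * γ) * ‖z.1.1 - xstar‖ ^ 2)).add measurable_const
  -- Independence makes the joint law a product, so the state can be frozen while the sample is
  -- integrated out.
  have hmap : P.map (fun ω => (z ω, ξ ω)) = (P.map z).prod (sampleLaw d n) := by
    rw [← hlaw]
    exact (indepFun_iff_map_prod_eq_prod_map_map hz.aemeasurable hξ.aemeasurable).1 hind
  have hpair : Measurable fun ω => (z ω, ξ ω) := hz.prodMk hξ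
  have hψi : Integrable ψ ((P.map z).prod (sampleLaw d n)) := by
    rw [← hmap, integrable_map_measure hψm.aestronglyMeasurable hpair.aemeasurable]
    exact i1.add i2
  have i345 : Integrable (fun ω => (1 / 2 - α) * potential f μ ν xstar (z ω).2 (z ω).1.2
      + 1 / 2 * potential f μ ν xstar (z ω).2 (z ω).2) P := i3.add i4
  have i345' : Integrable (fun ω => (1 / 2 - α) * potential f μ ν xstar (z ω).2 (z ω).1.2
      + 1 / 2 * potential f μ ν xstar (z ω).2 (z ω).2
      + α / (2 * γ) * ‖(z ω).1.1 - xstar‖ ^ 2) P := i345.add i5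
  have hφi : Integrable φ (P.map z) := by
    rw [integrable_map_measure hφm.aestronglyMeasurable hz.aemeasurable]
    exact i345'.add (integrable_const _)
  have hle : ∫ w, ψ w ∂((P.map z).prod (sampleLaw d n)) ≤ ∫ z, φ z ∂(P.map z) := by
    rw [integral_prod _ hψi]
    refine integral_mono_ae hψi.integral_prod_left hφi ?_
    filter_upwards [hψi.prod_right_ae] with w hw
    exact hf.integral_potential_step_le hn hL hμ hγ hα hα2 hγα xstar w hw
  rw [← hmap, integral_map hpair.aemeasurable hψm.aestronglyMeasurable,
    integral_map hz.aemeasurable hφm.aestronglyMeasurable] at hle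
  simp only [ψ, φ] at hle
  rw [integral_add i1 i2, integral_add i345' (integrable_const _), integral_add i345 i5,
    integral_add i3 i4] at hle
  simp only [integral_const_mul] at hle
  simpa using hle

end Random

/-! ### Filtration of the samples. -/

section Independence

variable {Ω : Type*} {u : ℕ → ℕ → Ω → Vec d} {i : ℕ → ℕ → Ω → Fin n}

/-- The sample drawn at iteration `k.2` of epoch `k.1`. -/
def sample (u : ℕ → ℕ → Ω → Vec d) (i : ℕ → ℕ → Ω → Fin n) (k : ℕ × ℕ) (ω : Ω) : Vec d × Fin n :=
  (u k.1 k.2 ω, i k.1 k.2 ω)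

/-- The information carried by the samples with index in `S`. -/
@[reducible]
def history (u : ℕ → ℕ → Ω → Vec d) (i : ℕ → ℕ → Ω → Fin n) (S : Set (ℕ × ℕ)) :
    MeasurableSpace Ω :=
  ⨆ k ∈ S, MeasurableSpace.comap (sample u i k) inferInstance

theorem history_mono {S T : Set (ℕ × ℕ)} (h : S ⊆ T) : history u i S ≤ history u i T :=
  biSup_mono h

theorem measurable_sample_history {S : Set (ℕ × ℕ)} {k : ℕ × ℕ} (hk : k ∈ S) :
    Measurable[history u i S] (sample u i k) :=
  Measurable.mono (comap_measurable _)
    (le_biSup (fun k => MeasurableSpace.comap (sample u i k) inferInstance) hk) le_rfl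

namespace IsSampling

variable [MeasurableSpace Ω] {P : Measure Ω}

theorem measurable_sample (h : IsSampling P u i) (k : ℕ × ℕ) : Measurable (sample u i k) :=
  (h.measurable_u k.1 k.2).prodMk (h.measurable_i k.1 k.2)

theorem history_le (h : IsSampling P u i) (S : Set (ℕ × ℕ)) :
    history u i S ≤ (inferInstance : MeasurableSpace Ω) :=
  iSup₂_le fun k _ => (h.measurable_sample k).comap_le

theorem map_sample [IsProbabilityMeasure P] (h : IsSampling P u i) (k : ℕ × ℕ) :
    P.map (sample u i k) = sampleLaw d n := by
  have := (indepFun_iff_map_prod_eq_prod_map_map (h.measurable_u k.1 k.2).aemeasurable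
    (h.measurable_i k.1 k.2).aemeasurable).1 (h.indep_pair k.1 k.2)
  rw [h.law_u, h.law_i] at this
  exact this

theorem indepFun_sample {X : Type*} [MeasurableSpace X] (h : IsSampling P u i)
    {S : Set (ℕ × ℕ)} {k : ℕ × ℕ} (hk : k ∉ S) {z : Ω → X} (hz : Measurable[history u i S] z) :
    IndepFun z (sample u i k) P := by
  have h1 := indep_iSup_of_disjoint (m := fun k => MeasurableSpace.comap (sample u i k) inferInstance)
    (fun k => (h.measurable_sample k).comap_le) h.iIndep.iIndep
    (Set.disjoint_singleton_right.2 hk)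
  rw [IndepFun_iff_Indep]
  refine indep_of_indep_of_le_left (indep_of_indep_of_le_right h1 ?_) hz.comap_le
  exact le_biSup (fun k => MeasurableSpace.comap (sample u i k) inferInstance)
    (Set.mem_singleton k)

end IsSampling

end Independence

/-! ### Positivity of the schedule and the total weights of an epoch. -/

section Schedule

theorem schedα_pos (d n s : ℕ) : 0 < schedα d n s := by
  unfold schedα
  split_ifs with h
  · norm_num
  · have : ((s0 d n : ℕ) : ℝ) < s := by exact_mod_cast not_le.1 h
    apply div_pos <;> linarith

theorem schedα_le_half (d n s : ℕ) : schedα d n s ≤ 1 / 2 := by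
  unfold schedα
  split_ifs with h
  · exact le_rfl
  · have : ((s0 d n : ℕ) : ℝ) < s := by exact_mod_cast not_le.1 h
    rw [div_le_div_iff₀ (by linarith) (by norm_num)]
    linarith

variable {L : ℝ}

theorem schedγ_pos (hL : 0 < L) (d n s : ℕ) : 0 < schedγ d n L s := by
  have := schedα_pos d n s
  unfold schedγ
  positivity

theorem schedγ_mul_schedα (hL : 0 < L) (d n s : ℕ) :
    12 * ((d : ℝ) + 4) * L * (schedγ d n L s * schedα d n s) = 1 := by
  have := schedα_pos d n s
  unfold schedγ
  field_simp

theorem schedT_pos (d n s : ℕ) : 0 < schedT d n s := by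
  unfold schedT
  split_ifs <;> positivity

/-- The total weight of the iterates of an epoch. -/
def epochWeight (d n : ℕ) (L : ℝ) (s : ℕ) : ℝ :=
  schedγ d n L s / schedα d n s * (((schedT d n s : ℝ) - 1) * (schedα d n s + 1 / 2) + 1)

/-- The weight of the pivot in the epoch inequality. -/
def pivotWeight (d n : ℕ) (L : ℝ) (s : ℕ) : ℝ :=
  schedγ d n L s / schedα d n s * (1 / 2 - schedα d n s + (schedT d n s : ℝ) / 2)

theorem sum_schedθ_mul (d n : ℕ) (L : ℝ) (s m : ℕ) (hm : schedT d n s = m + 1) (A : ℕ → ℝ) :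
    ∑ t ∈ Finset.Icc 1 (schedT d n s), schedθ d n L s t * A t =
      schedγ d n L s / schedα d n s *
        (∑ t ∈ Finset.Icc 1 m, (schedα d n s + 1 / 2) * A t + A (m + 1)) := by
  rw [hm, Finset.sum_Icc_succ_top (by omega), mul_add, Finset.mul_sum]
  congr 1
  · refine Finset.sum_congr rfl fun t ht => ?_
    have := (Finset.mem_Icc.1 ht).2
    rw [schedθ, if_pos (by omega)]
    ring
  · rw [schedθ, if_neg (by omega)]

theorem sum_schedθ (d n : ℕ) (L : ℝ) (s : ℕ) :
    ∑ t ∈ Finset.Icc 1 (schedT d n s), schedθ d n L s t = epochWeight d n L s := by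
  obtain ⟨m, hm⟩ := Nat.exists_eq_add_one.2 (schedT_pos d n s)
  have := sum_schedθ_mul d n L s m hm fun _ => 1
  simp only [mul_one] at this
  rw [this, epochWeight, hm, Finset.sum_const, Nat.card_Icc, Nat.add_sub_cancel, nsmul_eq_mul]
  push_cast
  ring

theorem epochWeight_pos (hL : 0 < L) (d n s : ℕ) : 0 < epochWeight d n L s := by
  have h1 := schedα_pos d n s
  have h2 := schedγ_pos hL d n s
  have h3 : (1 : ℝ) ≤ schedT d n s := by exact_mod_cast schedT_pos d n s
  have h4 : 0 ≤ ((schedT d n s : ℝ) - 1) * (schedα d n s + 1 / 2) :=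
    mul_nonneg (by linarith) (by linarith)
  unfold epochWeight
  positivity

theorem pivotWeight_nonneg (hL : 0 < L) (d n s : ℕ) : 0 ≤ pivotWeight d n L s := by
  have h1 := schedα_pos d n s
  have h2 := schedγ_pos hL d n s
  have h3 := schedα_le_half d n s
  have h4 : 0 ≤ 1 / 2 - schedα d n s := by linarith
  unfold pivotWeight
  positivity

theorem schedθ_nonneg (hL : 0 < L) (d n s t : ℕ) : 0 ≤ schedθ d n L s t := by
  have h1 := schedα_pos d n s
  have h2 := schedγ_pos hL d n s
  unfold schedθ
  split_ifs <;> positivity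

end Schedule

/-- Summation of the one-step recursion over an epoch of `m + 1` iterations. -/
theorem sum_recursion_le {A X : ℕ → ℝ} {α κ e : ℝ}
    (h : ∀ t, A (t + 1) + κ * X (t + 1) ≤ (1 / 2 - α) * A t + 1 / 2 * A 0 + κ * X t + e) (m : ℕ) :
    (∑ t ∈ Finset.Icc 1 m, (α + 1 / 2) * A t + A (m + 1)) + κ * X (m + 1) ≤
      (1 / 2 - α + ((m : ℝ) + 1) / 2) * A 0 + κ * X 0 + (m + 1) * e := by
  induction m with
  | zero =>
    have := h 0
    simp only [zero_add] at this ⊢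
    simp only [show Finset.Icc 1 0 = (∅ : Finset ℕ) from rfl, Finset.sum_empty]
    push_cast
    linarith
  | succ m ih =>
    rw [Finset.sum_Icc_succ_top (by omega)]
    -- The left side holds A (m + 1) with weight 1 and this step consumes 1/2 − α of it. The
    -- remaining α + 1/2 is the factor in θ_t for t < T_s.
    have := h (m + 1)
    push_cast
    linarith

/-! ### The trajectory of the algorithm: measurability, independence and square integrability. -/

section Iterates

variable {Ω : Type*}

/-- The pair `(x^s, x̃^s)` of the algorithm with the convex schedule. -/
def iterate (f : Fin n → Vec d → ℝ) (L μ ν : ℝ) (x0 : Vec d) (u : ℕ → ℕ → Ω → Vec d)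
    (i : ℕ → ℕ → Ω → Fin n) (s : ℕ) (ω : Ω) : Vec d × Vec d :=
  epoch (convexParams d n L) f μ ν x0 (fun s t => sample u i (s, t) ω) s

/-- The pair `(x_t, x̄_t)` of epoch `s + 1` of the algorithm with the convex schedule. -/
def innerIterate (f : Fin n → Vec d → ℝ) (L μ ν : ℝ) (x0 : Vec d) (u : ℕ → ℕ → Ω → Vec d)
    (i : ℕ → ℕ → Ω → Fin n) (s t : ℕ) (ω : Ω) : Vec d × Vec d :=
  innerIter f μ ν (schedγ d n L (s + 1)) (schedα d n (s + 1)) (1 / 2) 0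
    (iterate f L μ ν x0 u i s ω).1 (iterate f L μ ν x0 u i s ω).2
    (fun t => sample u i (s + 1, t) ω) t

variable (f : Fin n → Vec d → ℝ) (L μ ν : ℝ) (x0 : Vec d) (u : ℕ → ℕ → Ω → Vec d)
  (i : ℕ → ℕ → Ω → Fin n)

theorem innerIterate_zero (s : ℕ) :
    innerIterate f L μ ν x0 u i s 0 = iterate f L μ ν x0 u i s := rfl

theorem innerIterate_succ (s t : ℕ) (ω : Ω) :
    innerIterate f L μ ν x0 u i s (t + 1) ω =
      innerStep f μ ν (schedγ d n L (s + 1)) (schedα d n (s + 1))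
        (innerIterate f L μ ν x0 u i s t ω, (iterate f L μ ν x0 u i s ω).2)
        (sample u i (s + 1, t + 1) ω) :=
  innerIter_succ _ _ _ _ _ _ _ _ _

theorem iterate_succ (s : ℕ) (ω : Ω) :
    iterate f L μ ν x0 u i (s + 1) ω =
      ((innerIterate f L μ ν x0 u i s (schedT d n (s + 1)) ω).1,
        (Finset.Icc 1 (schedT d n (s + 1))).centerMass (schedθ d n L (s + 1))
          fun t => (innerIterate f L μ ν x0 u i s t ω).2) := rfl

end Iterates

section Trajectory

variable {Ω : Type*} {f : Fin n → Vec d → ℝ} {L μ ν : ℝ} {x0 : Vec d} {u : ℕ → ℕ → Ω → Vec d}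
  {i : ℕ → ℕ → Ω → Fin n}

theorem measurable_innerIterate_history (hn : 0 < n) (hf : ConvexSmooth f L) {s : ℕ}
    (h : Measurable[history u i {k | k.1 ≤ s}] (iterate f L μ ν x0 u i s)) (t : ℕ) :
    Measurable[history u i {k | k.1 ≤ s ∨ k.1 = s + 1 ∧ k.2 ≤ t}]
      (innerIterate f L μ ν x0 u i s t) := by
  induction t with
  | zero =>
    rw [innerIterate_zero]
    exact h.mono (history_mono fun k hk => Or.inl hk) le_rfl
  | succ t ih =>
    have h1 : Measurable[history u i {k | k.1 ≤ s ∨ k.1 = s + 1 ∧ k.2 ≤ t + 1}]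
        (innerIterate f L μ ν x0 u i s t) :=
      ih.mono (history_mono fun k hk => hk.imp_right fun hk => ⟨hk.1, hk.2.trans (Nat.le_succ t)⟩)
        le_rfl
    have h2 : Measurable[history u i {k | k.1 ≤ s ∨ k.1 = s + 1 ∧ k.2 ≤ t + 1}]
        (iterate f L μ ν x0 u i s) :=
      h.mono (history_mono fun k hk => Or.inl hk) le_rfl
    have h3 := measurable_sample_history (u := u) (i := i)
      (S := {k | k.1 ≤ s ∨ k.1 = s + 1 ∧ k.2 ≤ t + 1}) (k := (s + 1, t + 1))
      (Or.inr ⟨rfl, le_rfl⟩)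
    have h4 := (hf.measurable_innerStep (μ := μ) (ν := ν) hn (schedγ d n L (s + 1))
      (schedα d n (s + 1))).comp ((h1.prodMk h2.snd).prodMk h3)
    simp only [Function.comp_def] at h4
    rwa [show innerIterate f L μ ν x0 u i s (t + 1) = _ from
      funext (innerIterate_succ f L μ ν x0 u i s t)]

theorem measurable_iterate_history (hn : 0 < n) (hf : ConvexSmooth f L) (s : ℕ) :
    Measurable[history u i {k | k.1 ≤ s}] (iterate f L μ ν x0 u i s) := by
  induction s with
  | zero => exact measurable_const
  | succ s ih =>
    have h1 : ∀ t, Measurable[history u i {k | k.1 ≤ s + 1}]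
        (innerIterate f L μ ν x0 u i s t) := fun t =>
      (measurable_innerIterate_history hn hf ih t).mono (history_mono fun k hk => by
        rcases hk with hk | hk
        · exact Nat.le_succ_of_le hk
        · exact hk.1.le) le_rfl
    simp only [funext fun ω => iterate_succ f L μ ν x0 u i s ω, Finset.centerMass]
    exact (h1 _).fst.prodMk (Measurable.fun_const_smul
      (Finset.measurable_fun_sum _ fun t _ => (h1 t).snd.fun_const_smul _) _)

variable [MeasurableSpace Ω] {P : Measure Ω}

theorem IsSampling.measurable_iterate (h : IsSampling P u i) (hn : 0 < n) (hf : ConvexSmooth f L)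
    (s : ℕ) : Measurable (iterate f L μ ν x0 u i s) :=
  (measurable_iterate_history hn hf s).mono (h.history_le _) le_rfl

theorem IsSampling.measurable_innerIterate (h : IsSampling P u i) (hn : 0 < n)
    (hf : ConvexSmooth f L) (s t : ℕ) : Measurable (innerIterate f L μ ν x0 u i s t) :=
  (measurable_innerIterate_history hn hf (measurable_iterate_history hn hf s) t).mono
    (h.history_le _) le_rfl

/-- The state is a function of earlier epochs and of the first t samples of this epoch, and (s + 1,
t + 1) is not among those indices. -/
theorem IsSampling.indepFun_state (h : IsSampling P u i) (hn : 0 < n)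
    (hf : ConvexSmooth f L) (s t : ℕ) :
    IndepFun (fun ω => (innerIterate f L μ ν x0 u i s t ω, (iterate f L μ ν x0 u i s ω).2))
      (sample u i (s + 1, t + 1)) P := by
  have h1 := measurable_iterate_history (u := u) (i := i) (μ := μ) (ν := ν) (x0 := x0) hn hf s
  have h2 := measurable_innerIterate_history hn hf h1 t
  have h3 : Measurable[history u i {k | k.1 ≤ s ∨ k.1 = s + 1 ∧ k.2 ≤ t}]
      (iterate f L μ ν x0 u i s) := h1.mono (history_mono fun k hk => Or.inl hk) le_rfl
  refine h.indepFun_sample (S := {k | k.1 ≤ s ∨ k.1 = s + 1 ∧ k.2 ≤ t}) ?_ (h2.prodMk h3.snd)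
  simp

variable [IsProbabilityMeasure P]

theorem memLp_innerIterate (h : IsSampling P u i) (hn : 0 < n) (hf : ConvexSmooth f L)
    (hL : 0 ≤ L) (hμ : 0 < μ) (hν : 0 < ν) {s : ℕ}
    (h1 : MemLp (fun ω => (iterate f L μ ν x0 u i s ω).1) 2 P)
    (h2 : MemLp (fun ω => (iterate f L μ ν x0 u i s ω).2) 2 P) (t : ℕ) :
    MemLp (fun ω => (innerIterate f L μ ν x0 u i s t ω).1) 2 P ∧
      MemLp (fun ω => (innerIterate f L μ ν x0 u i s t ω).2) 2 P := by
  induction t with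
  | zero => exact ⟨h1, h2⟩
  | succ t ih =>
    simp only [innerIterate_succ]
    exact memLp_innerStep hn hf hL hμ hν _ _
      ((h.measurable_innerIterate hn hf s t).prodMk (h.measurable_iterate hn hf s).snd)
      (h.measurable_sample _) (h.map_sample _) (h.indepFun_state hn hf s t) ih.1 ih.2 h2

theorem memLp_iterate (h : IsSampling P u i) (hn : 0 < n) (hf : ConvexSmooth f L)
    (hL : 0 ≤ L) (hμ : 0 < μ) (hν : 0 < ν) (s : ℕ) :
    MemLp (fun ω => (iterate f L μ ν x0 u i s ω).1) 2 P ∧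
      MemLp (fun ω => (iterate f L μ ν x0 u i s ω).2) 2 P := by
  induction s with
  | zero => exact ⟨memLp_const x0, memLp_const x0⟩
  | succ s ih =>
    have h1 := memLp_innerIterate h hn hf hL hμ hν ih.1 ih.2
    simp only [iterate_succ, Finset.centerMass]
    have h2 : MemLp (fun ω => ∑ t ∈ Finset.Icc 1 (schedT d n (s + 1)),
        schedθ d n L (s + 1) t • (innerIterate f L μ ν x0 u i s t ω).2) 2 P :=
      memLp_finsetSum _ fun t _ => (h1 t).2.const_smul (schedθ d n L (s + 1) t)
    exact ⟨(h1 _).1, 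
      h2.const_smul (∑ t ∈ Finset.Icc 1 (schedT d n (s + 1)), schedθ d n L (s + 1) t)⁻¹⟩

end Trajectory

/-- For a fixed pivot the tilt is affine, so the potential is convex and Jensen's inequality
applies. -/
theorem potential_centerMass_le {f : Fin n → Vec d → ℝ} {L μ ν : ℝ} (hn : 0 < n)
    (hf : ConvexSmooth f L) (hL : 0 ≤ L) (xstar pv : Vec d) (s : Finset ℕ) {w : ℕ → ℝ}
    (hw : ∀ t ∈ s, 0 ≤ w t) (hw0 : 0 < ∑ t ∈ s, w t) (y : ℕ → Vec d) :
    (∑ t ∈ s, w t) * potential f μ ν xstar pv (s.centerMass w y) ≤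
      ∑ t ∈ s, w t * potential f μ ν xstar pv (y t) := by
  have hconv : ConvexOn ℝ Set.univ (potential f μ ν xstar pv) := by
    have h1 := (hf.isConvexSmooth_average hn).convexOn_smoothed (μ := μ) hL
    have h2 : ConvexOn ℝ Set.univ (innerSL ℝ
        (coordEst (average f) ν pv - smoothGrad (average f) μ pv)) :=
      (innerSL ℝ _).toLinearMap.convexOn convex_univ
    refine ((h1.add h2).add (convexOn_const (-smoothed (average f) μ xstar
      - inner ℝ (coordEst (average f) ν pv - smoothGrad (average f) μ pv) xstar)
      convex_univ)).congr fun y _ => ?_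
    simp only [Pi.add_apply, innerSL_apply_apply, potential, inner_sub_right]
    ring
  have h : potential f μ ν xstar pv (s.centerMass w y) ≤
      (∑ t ∈ s, w t)⁻¹ * ∑ t ∈ s, w t * potential f μ ν xstar pv (y t) :=
    hconv.map_centerMass_le hw hw0 (p := y) fun _ _ => Set.mem_univ _
  rwa [inv_mul_eq_div, le_div_iff₀ hw0, mul_comm] at h

/-! ### From inner steps to epochs. -/

/-- The recursion satisfied by the expected gap and the expected squared distance. -/
theorem epoch_recursion {Ω : Type*} [MeasurableSpace Ω] {P : Measure Ω} [IsProbabilityMeasure P]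
    {f : Fin n → Vec d → ℝ} {L μ ν : ℝ} {x0 : Vec d} {u : ℕ → ℕ → Ω → Vec d}
    {i : ℕ → ℕ → Ω → Fin n} (h : IsSampling P u i) (hn : 0 < n) (hf : ConvexSmooth f L)
    (hL : 0 < L) (hμ : 0 < μ) (hν : 0 < ν) (xstar : Vec d) {Z : ℝ}
    (hZ : ∀ s, ∫ ω, ‖(iterate f L μ ν x0 u i s ω).2 - xstar‖ ∂P ≤ Z) (s : ℕ) :
    epochWeight d n L (s + 1) * ∫ ω, (smoothed (average f) μ (iterate f L μ ν x0 u i (s + 1) ω).2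
          - smoothed (average f) μ xstar) ∂P
        + 1 / 2 * ∫ ω, ‖(iterate f L μ ν x0 u i (s + 1) ω).1 - xstar‖ ^ 2 ∂P ≤
      pivotWeight d n L (s + 1) * ∫ ω, (smoothed (average f) μ (iterate f L μ ν x0 u i s ω).2
          - smoothed (average f) μ xstar) ∂P
        + 1 / 2 * ∫ ω, ‖(iterate f L μ ν x0 u i s ω).1 - xstar‖ ^ 2 ∂P
        + schedγ d n L (s + 1) / schedα d n (s + 1) * schedT d n (s + 1) * err1 d L μ
        + err2 d L μ ν Z * (epochWeight d n L (s + 1) + pivotWeight d n L (s + 1)) := by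
  set α := schedα d n (s + 1) with hαdef
  set γ := schedγ d n L (s + 1) with hγdef
  have hα : 0 < α := schedα_pos d n (s + 1)
  have hα2 : α ≤ 1 / 2 := schedα_le_half d n (s + 1)
  have hγ : 0 < γ := schedγ_pos hL d n (s + 1)
  have hγα : 12 * ((d : ℝ) + 4) * L * (γ * α) = 1 := schedγ_mul_schedα hL d n (s + 1)
  obtain ⟨hx, hp⟩ := memLp_iterate h hn hf hL.le hμ hν (x0 := x0) s
  obtain ⟨hx', hp'⟩ := memLp_iterate h hn hf hL.le hμ hν (x0 := x0) (s + 1)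
  have hin := memLp_innerIterate h hn hf hL.le hμ hν hx hp
  let A : ℕ → ℝ := fun t => ∫ ω, potential f μ ν xstar (iterate f L μ ν x0 u i s ω).2
    (innerIterate f L μ ν x0 u i s t ω).2 ∂P
  let X : ℕ → ℝ := fun t => ∫ ω, ‖(innerIterate f L μ ν x0 u i s t ω).1 - xstar‖ ^ 2 ∂P
  have hrec : ∀ t, A (t + 1) + α / (2 * γ) * X (t + 1) ≤
      (1 / 2 - α) * A t + 1 / 2 * A 0 + α / (2 * γ) * X t + err1 d L μ := by
    intro t
    have := expected_potential_step_le hn hf hL hμ hν hγ hα hα2 hγα xstar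
      ((h.measurable_innerIterate hn hf s t).prodMk (h.measurable_iterate hn hf s).snd)
      (h.measurable_sample _) (h.map_sample _) (h.indepFun_state hn hf s t)
      (hin t).1 (hin t).2 hp
    simpa only [A, X, innerIterate_succ, innerIterate_zero] using this
  obtain ⟨m, hm⟩ := Nat.exists_eq_add_one.2 (schedT_pos d n (s + 1))
  have hsum := sum_recursion_le hrec m
  have hiA : ∀ t, Integrable (fun ω => potential f μ ν xstar (iterate f L μ ν x0 u i s ω).2
      (innerIterate f L μ ν x0 u i s t ω).2) P := fun t =>
    integrable_potential hn hf hL.le hν xstar (hin t).2 hp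
  have hjensen : epochWeight d n L (s + 1) * ∫ ω, potential f μ ν xstar
      (iterate f L μ ν x0 u i s ω).2 (iterate f L μ ν x0 u i (s + 1) ω).2 ∂P ≤
      γ / α * (∑ t ∈ Finset.Icc 1 m, (α + 1 / 2) * A t + A (m + 1)) := by
    rw [← sum_schedθ_mul d n L (s + 1) m hm A, ← integral_const_mul]
    simp only [A, ← integral_const_mul]
    rw [← integral_finsetSum _ fun t _ => (hiA t).const_mul _]
    refine integral_mono ((integrable_potential hn hf hL.le hν xstar hp' hp).const_mul _)
      (integrable_finsetSum _ fun t _ => (hiA t).const_mul _) fun ω => ?_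
    have := potential_centerMass_le (μ := μ) (ν := ν) hn hf hL.le xstar
      (iterate f L μ ν x0 u i s ω).2 (Finset.Icc 1 (schedT d n (s + 1)))
      (w := schedθ d n L (s + 1)) (fun t _ => schedθ_nonneg hL d n (s + 1) t)
      (by rw [sum_schedθ]; exact epochWeight_pos hL d n (s + 1))
      (fun t => (innerIterate f L μ ν x0 u i s t ω).2)
    rw [sum_schedθ] at this
    simpa only [iterate_succ] using this
  -- The tilt is removed only here, at the new and the old pivot, the points covered by `hZ`.
  have hb1 := (abs_le.1 (integral_potential_sub_abs_le (μ := μ) hn hf hL.le hν xstar hp' hp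
    (hZ (s + 1)))).1
  have hb2 := (abs_le.1 (integral_potential_sub_abs_le (μ := μ) hn hf hL.le hν xstar hp hp
    (hZ s))).2
  have hW := epochWeight_pos hL d n (s + 1)
  have hR := pivotWeight_nonneg hL d n (s + 1)
  have hb1' := mul_le_mul_of_nonneg_left hb1 hW.le
  have hb2' := mul_le_mul_of_nonneg_left hb2 hR
  have hsum' := mul_le_mul_of_nonneg_left hsum (by positivity : 0 ≤ γ / α)
  -- Multiplication by γ/α gives the distance term the coefficient 1/2 in every epoch, which lets it
  -- telescope across epochs.
  have hX : ∀ y : ℝ, γ / α * (α / (2 * γ) * y) = 1 / 2 * y := fun y => by field_simp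
  have hT : (schedT d n (s + 1) : ℝ) = m + 1 := by rw [hm]; push_cast; rfl
  have hRdef : pivotWeight d n L (s + 1) = γ / α * (1 / 2 - α + ((m : ℝ) + 1) / 2) := by
    rw [pivotWeight, hT]
  have hXm : ∫ ω, ‖(iterate f L μ ν x0 u i (s + 1) ω).1 - xstar‖ ^ 2 ∂P = X (m + 1) := by
    simp only [X, iterate_succ, hm]
  have hX0 : ∫ ω, ‖(iterate f L μ ν x0 u i s ω).1 - xstar‖ ^ 2 ∂P = X 0 := rfl
  have hA0 : ∫ ω, potential f μ ν xstar (iterate f L μ ν x0 u i s ω).2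
      (iterate f L μ ν x0 u i s ω).2 ∂P = A 0 := rfl
  rw [hA0, hRdef] at hb2'
  rw [hXm, hX0, hRdef, hT]
  linarith [hX (X (m + 1)), hX (X 0)]

/-! ### Explicit weights and accumulation of errors over epochs. -/

section Weights

variable {L : ℝ}

/-- With α = 1/2 all θ_t coincide and the weights double, so the pivot weight here is the total
weight of the preceding epoch when s ≥ 1. -/
theorem sched_early (hL : 0 < L) {s : ℕ} (hs : s + 1 ≤ s0 d n) :
    schedγ d n L (s + 1) / schedα d n (s + 1) * schedT d n (s + 1)
        = 1 / (3 * ((d : ℝ) + 4) * L) * 2 ^ s ∧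
      epochWeight d n L (s + 1) = 1 / (3 * ((d : ℝ) + 4) * L) * 2 ^ s ∧
      pivotWeight d n L (s + 1) = 1 / (3 * ((d : ℝ) + 4) * L) * 2 ^ s / 2 := by
  have hα : schedα d n (s + 1) = 1 / 2 := if_pos hs
  have hT : (schedT d n (s + 1) : ℝ) = 2 ^ s := by
    rw [schedT, if_pos hs]; simp
  have hγ : schedγ d n L (s + 1) / schedα d n (s + 1) = 1 / (3 * ((d : ℝ) + 4) * L) := by
    rw [schedγ, hα]; field_simp; norm_num
  rw [epochWeight, pivotWeight, hγ, hT, hα]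
  refine ⟨rfl, ?_, ?_⟩ <;> ring

theorem sched_late (hL : 0 < L) (j : ℕ) :
    schedγ d n L (s0 d n + (j + 1)) / schedα d n (s0 d n + (j + 1))
          * schedT d n (s0 d n + (j + 1))
        = 1 / (48 * ((d : ℝ) + 4) * L) * (((j : ℝ) + 5) ^ 2 * 2 ^ (s0 d n - 1)) ∧
      epochWeight d n L (s0 d n + (j + 1)) = 1 / (48 * ((d : ℝ) + 4) * L) *
        ((2 ^ (s0 d n - 1) + 1) * ((j : ℝ) + 5) ^ 2 / 2
          + 2 * (2 ^ (s0 d n - 1) - 1) * ((j : ℝ) + 5)) ∧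
      pivotWeight d n L (s0 d n + (j + 1)) = 1 / (48 * ((d : ℝ) + 4) * L) *
        ((2 ^ (s0 d n - 1) + 1) * ((j : ℝ) + 5) ^ 2 / 2 - 2 * ((j : ℝ) + 5)) := by
  have hs : ¬ s0 d n + (j + 1) ≤ s0 d n := by omega
  have hα : schedα d n (s0 d n + (j + 1)) = 2 / ((j : ℝ) + 5) := by
    rw [schedα, if_neg hs]; push_cast; congr 1; ring
  have hT : (schedT d n (s0 d n + (j + 1)) : ℝ) = 2 ^ (s0 d n - 1) := by
    rw [schedT, if_neg hs]; simp
  have hγ : schedγ d n L (s0 d n + (j + 1)) / schedα d n (s0 d n + (j + 1)) =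
      1 / (48 * ((d : ℝ) + 4) * L) * ((j : ℝ) + 5) ^ 2 := by
    rw [schedγ, hα]; field_simp; norm_num
  rw [epochWeight, pivotWeight, hγ, hT, hα]
  refine ⟨by ring, ?_, ?_⟩ <;> field_simp <;> ring

end Weights

/-- Error accumulation over the epochs with constant step sizes. -/
theorem early_bound {g D : ℕ → ℝ} {c e1 e2 : ℝ} {S : ℕ}
    (h : ∀ s, s + 1 ≤ S → c * 2 ^ s * g (s + 1) + 1 / 2 * D (s + 1) ≤
      c * 2 ^ s / 2 * g s + 1 / 2 * D s + c * 2 ^ s * e1 + e2 * (c * 2 ^ s + c * 2 ^ s / 2))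
    (s : ℕ) (hs : s ≤ S) :
    c * 2 ^ s / 2 * g s + 1 / 2 * D s ≤
      (c / 2 * g 0 + 1 / 2 * D 0) + c * (2 ^ s - 1) * e1 + 3 / 2 * c * (2 ^ s - 1) * e2 := by
  induction s with
  | zero => simp
  | succ s ih =>
    have h1 := ih (by omega)
    have h2 := h s hs
    rw [pow_succ]
    linarith

/-- Error accumulation over the epochs with decreasing `α`. -/
theorem late_bound {g D : ℕ → ℝ} {c T e1 e2 B : ℝ} (hc : 0 < c) (hT : 1 ≤ T) (hg : ∀ j, 0 ≤ g j)
    (he1 : 0 ≤ e1) (he2 : 0 ≤ e2) {W R : ℕ → ℝ}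
    (hW : ∀ j, W j = c * ((T + 1) * ((j : ℝ) + 4) ^ 2 / 2 + 2 * (T - 1) * ((j : ℝ) + 4)))
    (hR : ∀ j, R j = c * ((T + 1) * ((j : ℝ) + 5) ^ 2 / 2 - 2 * ((j : ℝ) + 5)))
    (h0 : W 0 * g 0 + 1 / 2 * D 0 ≤ B)
    (h : ∀ j, W (j + 1) * g (j + 1) + 1 / 2 * D (j + 1) ≤
      R j * g j + 1 / 2 * D j + c * (((j : ℝ) + 5) ^ 2 * T) * e1 + e2 * (W (j + 1) + R j))
    (j : ℕ) :
    W j * g j + 1 / 2 * D j ≤ B + j * (2 * W j * (e1 + e2)) := by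
  induction j with
  | zero => simpa using h0
  | succ j ih =>
    have hj : (0 : ℝ) ≤ j := Nat.cast_nonneg j
    -- This inequality is what the choice α = 2/(j + 5) secures: the next epoch asks of its pivot no
    -- more weight than is available.
    have hRW : R j ≤ W j := by
      rw [hR, hW]
      gcongr
      nlinarith [mul_nonneg (by linarith : 0 ≤ T - 1) hj]
    have hWW : W j ≤ W (j + 1) := by
      rw [hW, hW]
      have : 0 ≤ T - 1 := by linarith
      push_cast
      gcongr <;> linarith
    have hTW : c * (((j : ℝ) + 5) ^ 2 * T) ≤ 2 * W (j + 1) := by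
      rw [hW, mul_left_comm 2 c]
      refine mul_le_mul_of_nonneg_left ?_ hc.le
      push_cast
      have : 0 ≤ (T - 1) * ((j : ℝ) + 1 + 4) := mul_nonneg (by linarith) (by linarith)
      nlinarith [sq_nonneg ((j : ℝ) + 5)]
    have h1 := mul_le_mul_of_nonneg_right hRW (hg j)
    have h2 := mul_le_mul_of_nonneg_right hTW he1
    have h3 := mul_le_mul_of_nonneg_left (hRW.trans hWW) he2
    have h4 : (j : ℝ) * (2 * W j * (e1 + e2)) ≤ j * (2 * W (j + 1) * (e1 + e2)) := by gcongr
    have h5 := h j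
    push_cast
    linarith

/-- The 6 is 2 + 4: each late epoch costs 2(e1 + e2), and the error inherited from the early epochs
is at most 4(e1 + e2), absorbed using j ≥ 1. -/
theorem late_bound_div {g D0 n d L T K j e1 e2 W : ℝ} (hL : 0 < L) (hd : 0 ≤ d) (hn : 0 < n)
    (hT : 0 < T) (hj : 1 ≤ j) (hK : K = j + 4) (hD0 : 0 ≤ D0) (he1 : 0 ≤ e1) (he2 : 0 ≤ e2)
    (hTn : (d + 4) * n ≤ 2 * T)
    (hW : 1 / (48 * (d + 4) * L) * (T * K ^ 2 / 2) ≤ W)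
    (h : W * g ≤ D0 / (12 * L) + 1 / (3 * (d + 4) * L) * T * (2 * e1 + 3 * e2)
      + j * (2 * W * (e1 + e2))) :
    g ≤ 16 * D0 / (n * K ^ 2) + 6 * j * (e1 + e2) := by
  have hK0 : 5 ≤ K := by linarith
  have hW0 : 0 < W := lt_of_lt_of_le (by positivity) hW
  refine le_of_mul_le_mul_left (h.trans ?_) hW0
  have h1 : D0 / (12 * L) ≤ W * (16 * D0 / (n * K ^ 2)) := by
    refine le_trans ?_ (mul_le_mul_of_nonneg_right hW (by positivity))
    have : 1 / (48 * (d + 4) * L) * (T * K ^ 2 / 2) * (16 * D0 / (n * K ^ 2)) =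
        D0 / (12 * L) * (2 * T / ((d + 4) * n)) := by field_simp; ring
    rw [this]
    exact le_mul_of_one_le_right (by positivity) ((one_le_div (by positivity)).2 hTn)
  have h2 : 1 / (3 * (d + 4) * L) * T * (2 * e1 + 3 * e2) ≤ W * (4 * j * (e1 + e2)) := by
    have a1 : 1 / (3 * (d + 4) * L) * T ≤ W * (4 / 3) := by
      refine le_trans ?_ (mul_le_mul_of_nonneg_right hW (by norm_num))
      have : 1 / (48 * (d + 4) * L) * (T * K ^ 2 / 2) * (4 / 3) =
        1 / (3 * (d + 4) * L) * T * (K ^ 2 / 24) := by field_simp; norm_num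
      rw [this]
      -- K ≥ 5 gives K² ≥ 25 > 24.
      exact le_mul_of_one_le_right (by positivity) (by nlinarith)
    calc _ ≤ W * (4 / 3) * (2 * e1 + 3 * e2) := by gcongr
      _ ≤ W * (4 / 3) * (3 * (e1 + e2)) := by gcongr; linarith
      _ = W * (4 * 1 * (e1 + e2)) := by ring
      _ ≤ _ := by gcongr
  linarith

end ZOVarag

end

/-! ### The convergence theorem. -/

theorem theorem1 :
    ∃ C : ℝ, 0 ≤ C ∧
      ∀ (d n : ℕ) (_hn : 0 < n)
        (f : Fin n → ZOVarag.Vec d → ℝ) (L : ℝ) (_hL : 0 < L)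
        (_hf : ZOVarag.ConvexSmooth f L)
        (μ ν : ℝ) (_hμ : 0 < μ) (_hν : 0 < ν)
        (x0 xstar : ZOVarag.Vec d)
        (_hstar : ∀ y, ZOVarag.smoothed (ZOVarag.average f) μ xstar
          ≤ ZOVarag.smoothed (ZOVarag.average f) μ y)
        (Ω : Type*) (_mΩ : MeasurableSpace Ω) (P : Measure Ω) (_hP : IsProbabilityMeasure P)
        (u : ℕ → ℕ → Ω → ZOVarag.Vec d) (i : ℕ → ℕ → Ω → Fin n)
        (_hsamp : ZOVarag.IsSampling P u i)
        (Z : ℝ)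
        (_hZ : ∀ s : ℕ, ∫ ω, ‖ZOVarag.pivot (ZOVarag.convexParams d n L) f μ ν x0 u i s ω
          - xstar‖ ∂P ≤ Z)
        (s : ℕ), 1 ≤ s →
        Integrable (fun ω => ZOVarag.smoothed (ZOVarag.average f) μ
            (ZOVarag.pivot (ZOVarag.convexParams d n L) f μ ν x0 u i s ω)
          - ZOVarag.smoothed (ZOVarag.average f) μ xstar) P ∧
        (s ≤ ZOVarag.s0 d n →
          ∫ ω, (ZOVarag.smoothed (ZOVarag.average f) μ
              (ZOVarag.pivot (ZOVarag.convexParams d n L) f μ ν x0 u i s ω)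
            - ZOVarag.smoothed (ZOVarag.average f) μ xstar) ∂P
          ≤ ((d : ℝ) + 4) * ZOVarag.D0 f L μ x0 xstar / 2 ^ (s + 1)
            + 2 * ZOVarag.err1 d L μ + 3 * ZOVarag.err2 d L μ ν Z) ∧
        (ZOVarag.s0 d n < s →
          ∫ ω, (ZOVarag.smoothed (ZOVarag.average f) μ
              (ZOVarag.pivot (ZOVarag.convexParams d n L) f μ ν x0 u i s ω)
            - ZOVarag.smoothed (ZOVarag.average f) μ xstar) ∂P
          ≤ 16 * ZOVarag.D0 f L μ x0 xstar
              / ((n : ℝ) * ((s : ℝ) - (ZOVarag.s0 d n : ℝ) + 4) ^ 2)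
            + C * ((s : ℝ) - (ZOVarag.s0 d n : ℝ))
              * (ZOVarag.err1 d L μ + ZOVarag.err2 d L μ ν Z)) := by
  refine ⟨6, by norm_num, ?_⟩
  intro d n hn f L hL hf μ ν hμ hν x0 xstar hstar Ω _ P _ u i hsamp Z hZ s hs
  let g : ℕ → ℝ := fun s => ∫ ω, (ZOVarag.smoothed (ZOVarag.average f) μ
      (ZOVarag.iterate f L μ ν x0 u i s ω).2 - ZOVarag.smoothed (ZOVarag.average f) μ xstar) ∂P
  let D : ℕ → ℝ := fun s => ∫ ω, ‖(ZOVarag.iterate f L μ ν x0 u i s ω).1 - xstar‖ ^ 2 ∂P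
  have hrec := ZOVarag.epoch_recursion hsamp hn hf hL hμ hν xstar hZ
  have hg : ∀ s, 0 ≤ g s := fun s => integral_nonneg fun ω => sub_nonneg.2 (hstar _)
  have hD : ∀ s, 0 ≤ D s := fun s => integral_nonneg fun ω => sq_nonneg _
  have hd0 : (0 : ℝ) ≤ d := Nat.cast_nonneg d
  have he1 : 0 ≤ ZOVarag.err1 d L μ := by unfold ZOVarag.err1; positivity
  have he2 : 0 ≤ ZOVarag.err2 d L μ ν Z := by
    have : 0 ≤ Z := (integral_nonneg fun ω => norm_nonneg _).trans (hZ 0)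
    unfold ZOVarag.err2
    positivity
  have hg0 : g 0 = ZOVarag.smoothed (ZOVarag.average f) μ x0
      - ZOVarag.smoothed (ZOVarag.average f) μ xstar := by
    simp [g, ZOVarag.iterate, ZOVarag.epoch]
  have hDz : D 0 = ‖x0 - xstar‖ ^ 2 := by simp [D, ZOVarag.iterate, ZOVarag.epoch]
  have hD0 : ZOVarag.D0 f L μ x0 xstar = 2 / ((d : ℝ) + 4) * g 0 + 6 * L * D 0 := by
    rw [hg0, hDz, ZOVarag.D0]
  have hD0nn : 0 ≤ ZOVarag.D0 f L μ x0 xstar := by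
    have := hg 0; have := hD 0
    rw [hD0]; positivity
  set c : ℝ := 1 / (3 * ((d : ℝ) + 4) * L) with hc
  have hearly := ZOVarag.early_bound (g := g) (D := D) (c := c) (e1 := ZOVarag.err1 d L μ)
    (e2 := ZOVarag.err2 d L μ ν Z) (S := ZOVarag.s0 d n) (fun s hs => by
      obtain ⟨w1, w2, w3⟩ := ZOVarag.sched_early (d := d) (n := n) hL hs
      have := hrec s
      rwa [w1, w2, w3] at this)
  have hB : c / 2 * g 0 + 1 / 2 * D 0 = ZOVarag.D0 f L μ x0 xstar / (12 * L) := by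
    rw [hD0, hc]; field_simp; ring
  have hcpos : 0 < c := by positivity
  refine ⟨(ZOVarag.integrable_smoothed_comp hn hf hL.le
    (ZOVarag.memLp_iterate hsamp hn hf hL.le hμ hν s).2).sub (integrable_const _), fun hs0 => ?_,
    fun hs0 => ?_⟩
  · change g s ≤ _
    have h1 := hearly s hs0
    rw [hB] at h1
    have h2 : c * 2 ^ s / 2 * g s ≤ c * 2 ^ s / 2 * (((d : ℝ) + 4) * ZOVarag.D0 f L μ x0 xstar
        / 2 ^ (s + 1) + 2 * ZOVarag.err1 d L μ + 3 * ZOVarag.err2 d L μ ν Z) := by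
      have e : c * 2 ^ s / 2 * (((d : ℝ) + 4) * ZOVarag.D0 f L μ x0 xstar / 2 ^ (s + 1)) =
          ZOVarag.D0 f L μ x0 xstar / (12 * L) := by
        rw [hc, pow_succ]; field_simp; ring
      have := hD s
      have := mul_nonneg hcpos.le he1
      have := mul_nonneg hcpos.le he2
      rw [mul_add, mul_add, e]
      linarith
    exact le_of_mul_le_mul_left h2 (by positivity)
  · change g s ≤ _
    -- Now s = s₀ + j + 1, so the number of late epochs is j + 1 ≥ 1.
    obtain ⟨j, rfl⟩ := Nat.exists_eq_add_of_lt hs0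
    set T : ℝ := 2 ^ (ZOVarag.s0 d n - 1) with hT
    have hT1 : 1 ≤ T := one_le_pow₀ (by norm_num)
    have hTs : (2 : ℝ) ^ ZOVarag.s0 d n = 2 * T := by
      rw [hT, ZOVarag.s0, Nat.add_sub_cancel, pow_succ]; ring
    set c' : ℝ := 1 / (48 * ((d : ℝ) + 4) * L) with hc'
    have hcc : c = 16 * c' := by rw [hc, hc']; field_simp; norm_num
    have hc'pos : 0 < c' := by positivity
    let W : ℕ → ℝ := fun j => c' * ((T + 1) * ((j : ℝ) + 4) ^ 2 / 2 + 2 * (T - 1) * ((j : ℝ) + 4))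
    let R : ℕ → ℝ := fun j => c' * ((T + 1) * ((j : ℝ) + 5) ^ 2 / 2 - 2 * ((j : ℝ) + 5))
    have hlate := ZOVarag.late_bound (g := fun j => g (ZOVarag.s0 d n + j))
      (D := fun j => D (ZOVarag.s0 d n + j)) (W := W) (R := R)
      (B := ZOVarag.D0 f L μ x0 xstar / (12 * L)
        + c * T * (2 * ZOVarag.err1 d L μ + 3 * ZOVarag.err2 d L μ ν Z))
      hc'pos hT1 (fun j => hg _) he1 he2 (fun _ => rfl) (fun _ => rfl)
      (by
        have h1 := hearly (ZOVarag.s0 d n) le_rfl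
        rw [hB, hTs] at h1
        have := mul_nonneg hcpos.le he1
        have := mul_nonneg hcpos.le he2
        -- The two phases join without loss: the late weight extrapolated to j = 0 equals the weight
        -- cT left by epoch s₀.
        have hW0 : W 0 = c * (2 * T) / 2 := by simp only [W, hcc]; push_cast; ring
        rw [hW0]
        simp only [add_zero]
        linarith)
      (fun j => by
        obtain ⟨w1, w2, w3⟩ := ZOVarag.sched_late (d := d) (n := n) hL j
        have := hrec (ZOVarag.s0 d n + j)
        rw [add_assoc, w1, w2, w3] at this
        have hWj : W (j + 1) = c' * ((T + 1) * ((j : ℝ) + 5) ^ 2 / 2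
            + 2 * (T - 1) * ((j : ℝ) + 5)) := by simp only [W]; push_cast; ring
        rw [hWj]
        exact this) (j + 1)
    -- The definition of s₀ as one more than the floor of the logarithm gives (d+4)n < 2^{s₀} = 2T;
    -- this trades T for n in the rate.
    have hTn : ((d : ℝ) + 4) * n ≤ 2 * T := by
      rw [← hTs]
      exact_mod_cast (Nat.lt_pow_succ_log_self (by norm_num : 1 < 2) ((d + 4) * n)).le
    have hDj := hD (ZOVarag.s0 d n + (j + 1))
    have hcast : (((ZOVarag.s0 d n + j + 1 : ℕ) : ℝ) - (ZOVarag.s0 d n : ℝ)) = (j : ℝ) + 1 := by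
      push_cast; ring
    rw [hcast]
    refine ZOVarag.late_bound_div (W := W (j + 1)) hL hd0 (Nat.cast_pos.2 hn) (by linarith)
      (by linarith [(Nat.cast_nonneg j : (0 : ℝ) ≤ j)]) rfl hD0nn he1 he2 hTn ?_ ?_
    · simp only [W]
      push_cast
      have hj0 : (0 : ℝ) ≤ j := Nat.cast_nonneg j
      have : 0 ≤ 2 * (T - 1) * ((j : ℝ) + 1 + 4) :=
        mul_nonneg (by linarith) (by linarith)
      gcongr
      nlinarith [sq_nonneg ((j : ℝ) + 1 + 4)]
    · simp only [Nat.cast_add, Nat.cast_one] at hlate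
      rw [add_assoc (ZOVarag.s0 d n) j 1]
      linarith
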